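/- Conventions. Put $\epsilon_1=1$, $\epsilon_2=\epsilon_3=-1$, indices modulo $3$. An almost paraquaternionic structure on a smooth manifold $M$ is a rank-3 subbundle $\sigma\subset \mathrm{End}(TM)$ having near each point a smooth local basis $\{J_1,J_2,J_3\}$ (a canonical local basis) with $J_\alpha^2=-\epsilon_\alpha \mathrm{Id}$ and $J_\alpha J_{\alpha+1}=-J_{\alpha+1}J_\alpha=\epsilon_{\alpha+2}J_{\alpha+2}$. If $g$ is a semi-Riemannian metric on $M$ with $g(J_\alpha X,J_\alpha Y)=\epsilon_\alpha g(X,Y)$ for every canonical local basis, then $(M,\sigma,g)$ is almost paraquaternionic hermitian; it is paraquaternionic Kähler if, moreover, $\sigma$ is parallel with respect to the Levi-Civita connection of $g$, i.e. $\nabla_X A$ is a section of $\sigma$ for every local section $A$ of $\sigma$ and every vector field $X$. Let $N$ be a manifold immersed in $M$ by $\iota:N\to M$ such that the induced metric $\iota^*g$ is nondegenerate. $N$ is a paraquaternionic CR-submanifold if there is a smooth distribution $\mathcal D\subset TN$ on which the induced metric is nondegenerate, such that, for every canonical local basis, $J_\alpha\mathcal D_p=\mathcal D_p$ and $J_\alpha\mathcal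 D^\perp_p\subset T_pN^\perp$, where $\mathcal D^\perp$ is the orthogonal complement of $\mathcal D$ in $TN$ (and $T_pN$ is identified with $\iota_*T_pN$). Let $(M',\sigma',g')$ be almost paraquaternionic hermitian. A semi-Riemannian submersion $\pi:N\to M'$ (a smooth surjective submersion with nondegenerate fibres whose differential preserves the scalar products of vectors orthogonal to the fibres) is a paraquaternionic CR-submersion if $\ker\pi_*=\mathcal D^\perp$ and, for each $p\in N$, $\pi_*:\mathcal D_p\to T_{\pi(p)}M'$ is an isometry compatible with the structures: for every canonical local basis $\{J'_\alpha\}$ of $\sigma'$ near $\pi(p)$ there is a canonical local basis $\{J_\alpha\}$ of $\sigma$ near $\iota(p)$ with $\pi_*\circ J_\alpha=J'_\alpha\circ\pi_*$ on $\mathcal D_p$ for $\alpha=1,2,3$. Theorem. Let $N$ be a paraquaternionic CR-submanifold of a paraquaternionic Kähler manifold $(M,\sigma,g)$ and let $(M',\sigma',g')$ be an almost paraquaternionic hermitian manifold. If $\pi:N\to M'$ is a paraquaternionic CR-submersion, then $(M',\sigma',g')$ is a paraquaternionic Kähler manifold. -/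

import Mathlib

open scoped Manifold ContDiff Bundle

noncomputable section

namespace ParaquaternionicCR

section Manifold

variable {E : Type*} [NormedAddCommGroup E] [NormedSpace ℝ E]
  {M : Type*} [TopologicalSpace M] [ChartedSpace E M]

/-- The field `x ↦ J x` of endomorphisms of the tangent spaces is smooth on `U`, as a section of
the bundle `End(TM)`. -/
def SmoothEndOn [IsManifold 𝓘(ℝ, E) ∞ M]
    (J : ∀ x : M, TangentSpace 𝓘(ℝ, E) x →L[ℝ] TangentSpace 𝓘(ℝ, E) x) (U : Set M) : Prop :=
  ContMDiffOn 𝓘(ℝ, E) (𝓘(ℝ, E).prod 𝓘(ℝ, E →L[ℝ] E)) ∞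
    (fun x ↦ Bundle.TotalSpace.mk' (E →L[ℝ] E)
      (E := fun x : M ↦ TangentSpace 𝓘(ℝ, E) x →L[ℝ] TangentSpace 𝓘(ℝ, E) x) x (J x)) U

/-- The vector field `x ↦ X x` is smooth on `U`. -/
def SmoothFieldOn (X : ∀ x : M, TangentSpace 𝓘(ℝ, E) x) (U : Set M)
    [IsManifold 𝓘(ℝ, E) ∞ M] : Prop :=
  ContMDiffOn 𝓘(ℝ, E) (𝓘(ℝ, E).prod 𝓘(ℝ, E)) ∞
    (fun x ↦ Bundle.TotalSpace.mk' E (E := fun x : M ↦ TangentSpace 𝓘(ℝ, E) x) x (X x)) U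

variable (E M) in
/-- A semi-Riemannian metric: a smooth field of nondegenerate symmetric bilinear forms on the
tangent spaces. (For the metrics adapted to an almost paraquaternionic structure the index is
automatically half the dimension, so no constancy of the index has to be required.) -/
structure SemiRiemannianMetric [IsManifold 𝓘(ℝ, E) ∞ M] where
  inner (x : M) : TangentSpace 𝓘(ℝ, E) x →L[ℝ] TangentSpace 𝓘(ℝ, E) x →L[ℝ] ℝ
  symm (x : M) (v w : TangentSpace 𝓘(ℝ, E) x) : inner x v w = inner x w v
  nondegenerate (x : M) (v : TangentSpace 𝓘(ℝ, E) x) (hv : ∀ w, inner x v w = 0) : v = 0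
  contMDiff : ContMDiff 𝓘(ℝ, E) (𝓘(ℝ, E).prod 𝓘(ℝ, E →L[ℝ] E →L[ℝ] ℝ)) ∞
    (fun x ↦ Bundle.TotalSpace.mk' (E →L[ℝ] E →L[ℝ] ℝ)
      (E := fun x : M ↦ TangentSpace 𝓘(ℝ, E) x →L[ℝ] TangentSpace 𝓘(ℝ, E) x →L[ℝ] ℝ)
      x (inner x))

/-- `∇` is the Levi-Civita connection of `g`: it is torsion-free and compatible with `g`. -/
structure IsLeviCivita [IsManifold 𝓘(ℝ, E) ∞ M] [FiniteDimensional ℝ E]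
    (g : SemiRiemannianMetric E M)
    (cov : CovariantDerivative 𝓘(ℝ, E) E (TangentSpace 𝓘(ℝ, E) : M → Type _)) : Prop where
  torsion_eq_zero : haveI := FiniteDimensional.complete ℝ E; cov.torsion = 0
  compatible (x : M) (v : TangentSpace 𝓘(ℝ, E) x) (Y Z : ∀ y : M, TangentSpace 𝓘(ℝ, E) y)
    (hY : MDiffAt (T% Y) x) (hZ : MDiffAt (T% Z) x) :
    (d% (fun y ↦ g.inner y (Y y) (Z y)) x) v
      = g.inner x (cov Y x v) (Z x) + g.inner x (Y x) (cov Z x v)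

/-- The signs `ε₁ = 1`, `ε₂ = ε₃ = -1`; the indices `1, 2, 3` modulo 3 are the elements `0, 1, 2`
of `Fin 3` (with its cyclic addition). -/
def eps : Fin 3 → ℝ := ![1, -1, -1]

/-- `J₁, J₂, J₃` are, over the open set `U`, smooth sections of the family `σ` of subspaces of
`End(T_x M)`, form a basis of `σ x` at each point `x` of `U`, and satisfy
`J_α² = -ε_α Id` and `J_α J_{α+1} = -J_{α+1} J_α = ε_{α+2} J_{α+2}`. -/
structure IsCanonicalLocalBasis [IsManifold 𝓘(ℝ, E) ∞ M]
    (σ : ∀ x : M, Submodule ℝ (TangentSpace 𝓘(ℝ, E) x →L[ℝ] TangentSpace 𝓘(ℝ, E) x))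
    (U : Set M)
    (J : Fin 3 → ∀ x : M, TangentSpace 𝓘(ℝ, E) x →L[ℝ] TangentSpace 𝓘(ℝ, E) x) : Prop where
  isOpen : IsOpen U
  smooth (α : Fin 3) : SmoothEndOn (J α) U
  linearIndependent (x : M) (hx : x ∈ U) : LinearIndependent ℝ (fun α ↦ J α x)
  span_eq (x : M) (hx : x ∈ U) : Submodule.span ℝ (Set.range fun α ↦ J α x) = σ x
  sq (x : M) (hx : x ∈ U) (α : Fin 3) :
    J α x ∘L J α x = (-eps α) • ContinuousLinearMap.id ℝ (TangentSpace 𝓘(ℝ, E) x)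
  mul_next (x : M) (hx : x ∈ U) (α : Fin 3) :
    J α x ∘L J (α + 1) x = eps (α + 2) • J (α + 2) x
  next_mul (x : M) (hx : x ∈ U) (α : Fin 3) :
    J (α + 1) x ∘L J α x = -(eps (α + 2) • J (α + 2) x)

variable (E M) in
/-- An almost paraquaternionic structure: a rank-3 subbundle `σ` of `End(TM)` that admits a
canonical local basis near every point. -/
structure AlmostParaquaternionicStructure [IsManifold 𝓘(ℝ, E) ∞ M] where
  fiber (x : M) : Submodule ℝ (TangentSpace 𝓘(ℝ, E) x →L[ℝ] TangentSpace 𝓘(ℝ, E) x)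
  exists_basis (x : M) : ∃ (U : Set M)
    (J : Fin 3 → ∀ y : M, TangentSpace 𝓘(ℝ, E) y →L[ℝ] TangentSpace 𝓘(ℝ, E) y),
    x ∈ U ∧ IsCanonicalLocalBasis fiber U J

/-- `(M, σ, g)` is an almost paraquaternionic hermitian manifold: `g` is adapted to `σ`, that is,
`g(J_α X, J_α Y) = ε_α g(X, Y)` for every canonical local basis. -/
def IsAlmostParaquaternionicHermitian [IsManifold 𝓘(ℝ, E) ∞ M]
    (σ : AlmostParaquaternionicStructure E M) (g : SemiRiemannianMetric E M) : Prop :=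
  ∀ (U : Set M) (J : Fin 3 → ∀ x : M, TangentSpace 𝓘(ℝ, E) x →L[ℝ] TangentSpace 𝓘(ℝ, E) x),
    IsCanonicalLocalBasis σ.fiber U J → ∀ x ∈ U, ∀ (α : Fin 3) (v w : TangentSpace 𝓘(ℝ, E) x),
      g.inner x (J α x v) (J α x w) = eps α * g.inner x v w

/-- The subbundle `σ` of `End(TM)` is parallel with respect to `∇`: for every local section `A` of
`σ` and every tangent vector `v` at a point `x`, the endomorphism `∇_v A`, which is given by
`(∇_v A) Y = ∇_v (A Y) - A (∇_v Y)`, belongs to `σ_x`. -/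
def IsParallel [IsManifold 𝓘(ℝ, E) ∞ M]
    (cov : CovariantDerivative 𝓘(ℝ, E) E (TangentSpace 𝓘(ℝ, E) : M → Type _))
    (σ : AlmostParaquaternionicStructure E M) : Prop :=
  ∀ (U : Set M) (A : ∀ x : M, TangentSpace 𝓘(ℝ, E) x →L[ℝ] TangentSpace 𝓘(ℝ, E) x),
    IsOpen U → SmoothEndOn A U → (∀ x ∈ U, A x ∈ σ.fiber x) →
    ∀ x ∈ U, ∀ v : TangentSpace 𝓘(ℝ, E) x, ∃ B ∈ σ.fiber x,
      ∀ Y : ∀ y : M, TangentSpace 𝓘(ℝ, E) y, MDiffAt (T% Y) x →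
        cov (fun y ↦ A y (Y y)) x v - A x (cov Y x v) = B (Y x)

/-- `(M, σ, g)` is a paraquaternionic Kähler manifold: it is almost paraquaternionic hermitian, and
`σ` is parallel with respect to the Levi-Civita connection of `g`. -/
structure IsParaquaternionicKahler [IsManifold 𝓘(ℝ, E) ∞ M] [FiniteDimensional ℝ E]
    (σ : AlmostParaquaternionicStructure E M) (g : SemiRiemannianMetric E M) : Prop where
  hermitian : IsAlmostParaquaternionicHermitian σ g
  parallel : ∃ cov : CovariantDerivative 𝓘(ℝ, E) E (TangentSpace 𝓘(ℝ, E) : M → Type _),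
    IsLeviCivita g cov ∧ IsParallel cov σ

/-- `D` is a smooth distribution: for some `r`, the subspaces `D x` are spanned near each point by
`r` smooth, pointwise linearly independent vector fields. -/
def IsSmoothDistribution [IsManifold 𝓘(ℝ, E) ∞ M]
    (D : ∀ x : M, Submodule ℝ (TangentSpace 𝓘(ℝ, E) x)) : Prop :=
  ∃ r : ℕ, ∀ x : M, ∃ (U : Set M) (s : Fin r → ∀ y : M, TangentSpace 𝓘(ℝ, E) y),
    IsOpen U ∧ x ∈ U ∧ (∀ i, SmoothFieldOn (s i) U) ∧
    ∀ y ∈ U, LinearIndependent ℝ (fun i ↦ s i y) ∧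
      Submodule.span ℝ (Set.range fun i ↦ s i y) = D y

end Manifold

section Submanifold

variable {E : Type*} [NormedAddCommGroup E] [NormedSpace ℝ E]
  {M : Type*} [TopologicalSpace M] [ChartedSpace E M] [IsManifold 𝓘(ℝ, E) ∞ M]
  {F : Type*} [NormedAddCommGroup F] [NormedSpace ℝ F]
  {N : Type*} [TopologicalSpace N] [ChartedSpace F N] [IsManifold 𝓘(ℝ, F) ∞ N]

/-- The form induced by `g` on `N` through `ι : N → M`: `(v, w) ↦ g(ι_* v, ι_* w)`. -/
def inducedForm (g : SemiRiemannianMetric E M) (ι : N → M) (p : N) :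
    LinearMap.BilinForm ℝ (TangentSpace 𝓘(ℝ, F) p) :=
  LinearMap.mk₂ ℝ
    (fun v w ↦ g.inner (ι p) (mfderiv 𝓘(ℝ, F) 𝓘(ℝ, E) ι p v) (mfderiv 𝓘(ℝ, F) 𝓘(ℝ, E) ι p w))
    (by intros; simp) (by intros; simp) (by intros; simp) (by intros; simp)

/-- The manifold `N`, immersed in the almost paraquaternionic hermitian manifold `(M, σ, g)` by
`ι`, is a paraquaternionic CR-submanifold with paraquaternionic distribution `D`. -/
structure IsParaquaternionicCRSubmanifold
    (σ : AlmostParaquaternionicStructure E M) (g : SemiRiemannianMetric E M) (ι : N → M)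
    (D : ∀ p : N, Submodule ℝ (TangentSpace 𝓘(ℝ, F) p)) : Prop where
  immersion : Manifold.IsImmersion 𝓘(ℝ, F) 𝓘(ℝ, E) ∞ ι
  nondegenerate (p : N) : (inducedForm (F := F) g ι p).Nondegenerate
  smooth : IsSmoothDistribution D
  nondegenerate_distribution (p : N) : ((inducedForm g ι p).restrict (D p)).Nondegenerate
  /-- `J_α D_p = D_p`. -/
  paraquaternionic (U : Set M)
    (J : Fin 3 → ∀ x : M, TangentSpace 𝓘(ℝ, E) x →L[ℝ] TangentSpace 𝓘(ℝ, E) x)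
    (hJ : IsCanonicalLocalBasis σ.fiber U J) (p : N) (hp : ι p ∈ U) (α : Fin 3) :
    ((D p).map (mfderiv 𝓘(ℝ, F) 𝓘(ℝ, E) ι p).toLinearMap).map (J α (ι p)).toLinearMap
      = (D p).map (mfderiv 𝓘(ℝ, F) 𝓘(ℝ, E) ι p).toLinearMap
  /-- `J_α D_p^⊥` is contained in the normal space of `N` at `p`. -/
  totally_real (U : Set M)
    (J : Fin 3 → ∀ x : M, TangentSpace 𝓘(ℝ, E) x →L[ℝ] TangentSpace 𝓘(ℝ, E) x)
    (hJ : IsCanonicalLocalBasis σ.fiber U J) (p : N) (hp : ι p ∈ U) (α : Fin 3)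
    (v : TangentSpace 𝓘(ℝ, F) p) (hv : v ∈ (inducedForm g ι p).orthogonal (D p))
    (w : TangentSpace 𝓘(ℝ, F) p) :
    g.inner (ι p) (J α (ι p) (mfderiv 𝓘(ℝ, F) 𝓘(ℝ, E) ι p v))
      (mfderiv 𝓘(ℝ, F) 𝓘(ℝ, E) ι p w) = 0

variable {E' : Type*} [NormedAddCommGroup E'] [NormedSpace ℝ E']
  {M' : Type*} [TopologicalSpace M'] [ChartedSpace E' M'] [IsManifold 𝓘(ℝ, E') ∞ M']

/-- `ker f_*`, the vertical subspace of a map `f` at `p`. -/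
def vertical (f : N → M') (p : N) : Submodule ℝ (TangentSpace 𝓘(ℝ, F) p) :=
  (mfderiv 𝓘(ℝ, F) 𝓘(ℝ, E') f p).toLinearMap.ker

/-- `f : (N, h) → (M', g')` is a semi-Riemannian submersion, `h` being a field of bilinear forms on
the tangent spaces of `N` (below: the metric of a nondegenerate submanifold). -/
structure IsSemiRiemannianSubmersion
    (h : ∀ p : N, LinearMap.BilinForm ℝ (TangentSpace 𝓘(ℝ, F) p))
    (g' : SemiRiemannianMetric E' M') (f : N → M') : Prop where
  smooth : ContMDiff 𝓘(ℝ, F) 𝓘(ℝ, E') ∞ f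
  surjective : Function.Surjective f
  surjective_mfderiv (p : N) : Function.Surjective (mfderiv 𝓘(ℝ, F) 𝓘(ℝ, E') f p)
  /-- The fibres are nondegenerate. -/
  nondegenerate_fibers (p : N) :
    ((h p).restrict (vertical (F := F) (E' := E') f p)).Nondegenerate
  /-- `f_*` preserves the scalar products of horizontal vectors. -/
  preserves (p : N) (v w : TangentSpace 𝓘(ℝ, F) p)
    (hv : v ∈ (h p).orthogonal (vertical (F := F) (E' := E') f p))
    (hw : w ∈ (h p).orthogonal (vertical (F := F) (E' := E') f p)) :
    g'.inner (f p) (mfderiv 𝓘(ℝ, F) 𝓘(ℝ, E') f p v) (mfderiv 𝓘(ℝ, F) 𝓘(ℝ, E') f p w) = h p v w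

/-- `f : N → M'` is a paraquaternionic CR-submersion of the CR-submanifold `(N, D)` of `(M, σ, g)`
onto `(M', σ', g')`. The condition `compatible` says that `f_* ∘ J_α = J'_α ∘ f_*` on `D_p`;
`D_p ⊆ T_p N` is regarded there as a subspace of `T_{ι p} M` through `ι_*`. -/
structure IsParaquaternionicCRSubmersion
    (σ : AlmostParaquaternionicStructure E M) (g : SemiRiemannianMetric E M) (ι : N → M)
    (D : ∀ p : N, Submodule ℝ (TangentSpace 𝓘(ℝ, F) p))
    (σ' : AlmostParaquaternionicStructure E' M') (g' : SemiRiemannianMetric E' M')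
    (f : N → M') : Prop where
  submersion : IsSemiRiemannianSubmersion (inducedForm (F := F) g ι) g' f
  vertical_eq (p : N) : vertical (F := F) (E' := E') f p = (inducedForm g ι p).orthogonal (D p)
  isometry (p : N) (v w : TangentSpace 𝓘(ℝ, F) p) (hv : v ∈ D p) (hw : w ∈ D p) :
    g'.inner (f p) (mfderiv 𝓘(ℝ, F) 𝓘(ℝ, E') f p v) (mfderiv 𝓘(ℝ, F) 𝓘(ℝ, E') f p w)
      = inducedForm g ι p v w
  /-- For each `p`, every canonical local basis `J'` of `σ'` near `f p` corresponds at `p` to some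
  canonical local basis `J` of `σ` near `ι p`. -/
  compatible (p : N) (U' : Set M')
    (J' : Fin 3 → ∀ x : M', TangentSpace 𝓘(ℝ, E') x →L[ℝ] TangentSpace 𝓘(ℝ, E') x)
    (hJ' : IsCanonicalLocalBasis σ'.fiber U' J') (hp : f p ∈ U') :
    ∃ (U : Set M) (J : Fin 3 → ∀ x : M, TangentSpace 𝓘(ℝ, E) x →L[ℝ] TangentSpace 𝓘(ℝ, E) x),
      IsCanonicalLocalBasis σ.fiber U J ∧ ι p ∈ U ∧
      ∀ (α : Fin 3), ∀ v ∈ D p, ∃ w ∈ D p,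
        mfderiv 𝓘(ℝ, F) 𝓘(ℝ, E) ι p w = J α (ι p) (mfderiv 𝓘(ℝ, F) 𝓘(ℝ, E) ι p v) ∧
        mfderiv 𝓘(ℝ, F) 𝓘(ℝ, E') f p w = J' α (f p) (mfderiv 𝓘(ℝ, F) 𝓘(ℝ, E') f p v)

end Submanifold

end ParaquaternionicCR

end

noncomputable section

namespace ParaquaternionicCR

set_option maxSynthPendingDepth 3

/-! ### Differentiable solutions of linear equations, and differentiable horizontal lifts. -/

section Local

open Filter Topology

/-! This is O'Neill's argument for submersions, applied to the composite of the immersion and the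
submersion. At each point `q` of `N` the horizontal lift `l` inverts `f_*` on `D q`, and `L = ι_* ∘
l` embeds the tangent space of the base isometrically into that of `M`, with image `ι_* D`. Let `R`
be the metric adjoint of `L`: the orthogonal projection of the tangent space of `M` onto `ι_* D`,
followed by `L⁻¹`. The candidate connection on the base is `∇'_v w = R(∇_v (L w))`, with `∇` the
Levi-Civita connection of `M`.

It is torsion-free because the bracket of lifts of constant fields is vertical, hence orthogonal to
`D`; it is metric because `L` is isometric. At the point considered, `J L = L J'` and `J` is skew,
so taking adjoints gives `R J = J' R`. A section `A` of `σ'` satisfies `L A = ∑ c_β J_β L` near that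
point; differentiating and applying `R` turns the parallelism of `σ` into that of `σ'`. This is
`LocalSubmersion.exists_christoffel`.

Two points of regularity matter. The compatible bases are given point by point, so the lift `l` and
the coefficients `c_β` must be shown differentiable: both solve linear equations that are injective
at the point, which is `exists_differentiableAt_of_mem_range`. On the other hand, the conditions
defining a Kähler structure are pointwise in the base point, so a separate choice of Christoffel
symbols at the centre of each chart suffices (`isParaquaternionicKahler_of_christoffel`). -/

/-- If `a q` lies in the range of `B q` for `q` near `p`, where `B` is differentiable and `B p`
injective, then `a q = B q (c q)` with `c` differentiable at `p`. -/
lemma exists_differentiableAt_of_mem_range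
    {X W V : Type*} [NormedAddCommGroup X] [NormedSpace ℝ X]
    [NormedAddCommGroup W] [NormedSpace ℝ W] [FiniteDimensional ℝ W]
    [NormedAddCommGroup V] [NormedSpace ℝ V] [FiniteDimensional ℝ V]
    {B : X → W →L[ℝ] V} {a : X → V} {p : X}
    (hB : DifferentiableAt ℝ B p) (ha : DifferentiableAt ℝ a p)
    (hinj : Function.Injective (B p)) (hmem : ∀ᶠ q in 𝓝 p, ∃ c, a q = B q c) :
    ∃ c : X → W, DifferentiableAt ℝ c p ∧ ∀ᶠ q in 𝓝 p, a q = B q (c q) := by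
  -- With `P` a left inverse of `B p`, the square family `P ∘ B q` is the identity at `p`, hence
  -- invertible nearby with differentiable inverse. Then `(P ∘ B q)⁻¹ P (a q)` recovers whatever
  -- coefficient exists at `q`.
  have := FiniteDimensional.complete ℝ W
  obtain ⟨P, hP⟩ := (B p).toLinearMap.exists_leftInverse_of_injective (LinearMap.ker_eq_bot.2 hinj)
  let P' : V →L[ℝ] W := LinearMap.toContinuousLinearMap P
  let T : X → W →L[ℝ] W := fun q ↦ P' ∘L B q
  have hT : DifferentiableAt ℝ T p := (differentiableAt_const P').clm_comp hB
  have hTp : T p = ContinuousLinearEquiv.refl ℝ W := by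
    ext w
    exact LinearMap.congr_fun hP w
  have hinv : DifferentiableAt ℝ (fun q ↦ (T q).inverse) p := by
    have h1 : DifferentiableAt ℝ (ContinuousLinearMap.inverse : (W →L[ℝ] W) → _) (T p) := by
      rw [hTp]
      exact (contDiffAt_map_inverse (n := 1) (ContinuousLinearEquiv.refl ℝ W)).differentiableAt
        one_ne_zero
    exact h1.comp p hT
  have hev : ∀ᶠ q in 𝓝 p, (T q).IsInvertible := by
    have h2 : Set.range ((↑) : (W ≃L[ℝ] W) → W →L[ℝ] W) ∈ 𝓝 (T p) := by
      rw [hTp]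
      exact ContinuousLinearEquiv.nhds _
    exact hT.continuousAt.eventually h2
  refine ⟨fun q ↦ (T q).inverse (P' (a q)),
    hinv.clm_apply ((differentiableAt_const P').clm_apply ha), ?_⟩
  filter_upwards [hmem, hev] with q ⟨c, hc⟩ hq
  have : (T q).inverse (P' (a q)) = c := by
    rw [hc]
    exact hq.inverse_apply_eq.2 rfl
  rw [this, hc]

variable {F E E' : Type*} [NormedAddCommGroup F] [NormedSpace ℝ F] [FiniteDimensional ℝ F]
  [NormedAddCommGroup E] [NormedSpace ℝ E]
  [NormedAddCommGroup E'] [NormedSpace ℝ E'] [FiniteDimensional ℝ E']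

/-- The pullback of a differentiable family of bilinear forms by differentiable families of linear
maps is differentiable. -/
lemma differentiableAt_bilinear_pullback
    {X V W V' W' Z : Type*} [NormedAddCommGroup X] [NormedSpace ℝ X]
    [NormedAddCommGroup V] [NormedSpace ℝ V] [NormedAddCommGroup W] [NormedSpace ℝ W]
    [NormedAddCommGroup V'] [NormedSpace ℝ V'] [NormedAddCommGroup W'] [NormedSpace ℝ W']
    [NormedAddCommGroup Z] [NormedSpace ℝ Z]
    {G : X → V →L[ℝ] W →L[ℝ] Z} {S : X → V' →L[ℝ] V} {T : X → W' →L[ℝ] W} {p : X}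
    (hG : DifferentiableAt ℝ G p) (hS : DifferentiableAt ℝ S p) (hT : DifferentiableAt ℝ T p) :
    DifferentiableAt ℝ (fun q ↦ (G q).bilinearComp (S q) (T q)) p := by
  have h1 : DifferentiableAt ℝ (fun q ↦ G q ∘L S q) p := hG.clm_comp hS
  have h2 : DifferentiableAt ℝ (fun q ↦ (ContinuousLinearMap.compL ℝ W' W Z).flip (T q)) p :=
    (ContinuousLinearMap.compL ℝ W' W Z).flip.differentiableAt.comp p hT
  exact h2.clm_comp h1

/-- A nondegenerate family of forms admits differentiable adjoints as soon as it admits adjoints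
pointwise. -/
lemma exists_differentiableAt_adjoint
    {H : F → F →L[ℝ] F →L[ℝ] ℝ} {a : F → E' →L[ℝ] F →L[ℝ] ℝ} {p : F}
    (hH : DifferentiableAt ℝ H p) (ha : DifferentiableAt ℝ a p)
    (hnd : ∀ z, (∀ u, H p z u = 0) → z = 0)
    (hlift : ∀ᶠ q in 𝓝 p, ∃ l : E' →L[ℝ] F, ∀ w u, H q (l w) u = a q w u) :
    ∃ l : F → E' →L[ℝ] F, DifferentiableAt ℝ l p ∧ ∀ᶠ q in 𝓝 p, ∀ w u,
      H q (l q w) u = a q w u := by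
  -- The adjoint equation is linear in `l`: it says that `a q` is the image of `l` under composition
  -- with `H q`, which is injective at `p` by nondegeneracy.
  have hB : DifferentiableAt ℝ (fun q ↦ ContinuousLinearMap.compL ℝ E' F (F →L[ℝ] ℝ) (H q)) p :=
    (ContinuousLinearMap.compL ℝ E' F (F →L[ℝ] ℝ)).differentiableAt.comp p hH
  obtain ⟨l, hl, hl'⟩ := exists_differentiableAt_of_mem_range hB ha (by
    refine (injective_iff_map_eq_zero _).2 fun l hl ↦ ?_
    ext w
    exact hnd _ fun u ↦ congr($hl w u)) (by
    filter_upwards [hlift] with q ⟨l, hl⟩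
    exact ⟨l, by ext w u; exact (hl w u).symm⟩)
  refine ⟨l, hl, ?_⟩
  filter_upwards [hl'] with q hq w u
  exact congr($hq w u).symm

/-- Pointwise existence of horizontal lifts for a nondegenerate induced form gives a horizontal
lift that depends differentiably on the point. -/
lemma exists_differentiableAt_horizontalLift
    {i : F → E} {f : F → E'} {G : E → E →L[ℝ] E →L[ℝ] ℝ} {G' : E' → E' →L[ℝ] E' →L[ℝ] ℝ} {p : F}
    (hi : ContDiffAt ℝ 2 i p) (hf : ContDiffAt ℝ 2 f p)
    (hG : DifferentiableAt ℝ G (i p)) (hG' : DifferentiableAt ℝ G' (f p))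
    (hnd : ∀ z, (∀ u, G (i p) (fderiv ℝ i p z) (fderiv ℝ i p u) = 0) → z = 0)
    (hlift : ∀ᶠ q in 𝓝 p, ∃ l : E' →L[ℝ] F, ∀ w u,
      G (i q) (fderiv ℝ i q (l w)) (fderiv ℝ i q u) = G' (f q) w (fderiv ℝ f q u)) :
    ∃ l : F → E' →L[ℝ] F, DifferentiableAt ℝ l p ∧ ∀ᶠ q in 𝓝 p, ∀ w u,
      G (i q) (fderiv ℝ i q (l q w)) (fderiv ℝ i q u) = G' (f q) w (fderiv ℝ f q u) := by
  have hdi : DifferentiableAt ℝ (fderiv ℝ i) p :=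
    (hi.fderiv_right (m := 1) (by norm_num)).differentiableAt one_ne_zero
  have hdf : DifferentiableAt ℝ (fderiv ℝ f) p :=
    (hf.fderiv_right (m := 1) (by norm_num)).differentiableAt one_ne_zero
  have hGi := hG.comp p (hi.differentiableAt two_ne_zero)
  have hGf := hG'.comp p (hf.differentiableAt two_ne_zero)
  exact exists_differentiableAt_adjoint (differentiableAt_bilinear_pullback hGi hdi hdi)
    (differentiableAt_bilinear_pullback hGf
      (differentiableAt_const (ContinuousLinearMap.id ℝ E')) hdf) hnd hlift

/-- The horizontal lift of tangent vectors, pushed forward to the ambient space. -/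
def ambientLift (i : F → E) (l : F → E' →L[ℝ] F) (q : F) : E' →L[ℝ] E := fderiv ℝ i q ∘L l q

end Local

/-! ### First-order identities for a semi-Riemannian submersion in coordinates. -/

section Local

open Filter Topology

variable {F E E' : Type*} [NormedAddCommGroup F] [NormedSpace ℝ F]
  [NormedAddCommGroup E] [NormedSpace ℝ E]
  [NormedAddCommGroup E'] [NormedSpace ℝ E']

lemma fderiv_bilinear_comp_apply
    {B : E → E →L[ℝ] E →L[ℝ] ℝ} {i : F → E} {S T : F → E} {p : F}
    (hB : DifferentiableAt ℝ B (i p)) (hi : DifferentiableAt ℝ i p)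
    (hS : DifferentiableAt ℝ S p) (hT : DifferentiableAt ℝ T p) (z : F) :
    fderiv ℝ (fun q ↦ B (i q) (S q) (T q)) p z
      = fderiv ℝ B (i p) (fderiv ℝ i p z) (S p) (T p) + B (i p) (fderiv ℝ S p z) (T p)
        + B (i p) (S p) (fderiv ℝ T p z) := by
  have h := (((hB.hasFDerivAt.comp p hi.hasFDerivAt).clm_apply hS.hasFDerivAt).clm_apply
    hT.hasFDerivAt).fderiv
  refine (congr($h z)).trans ?_
  simp
  ring

/-- First-order data at a point of a map `i : F → (E, G)` and a submersion `f : F → (E', G')`,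
with differentiable horizontal lift `l`, preserving the scalar products of horizontal vectors, and
the value `Γ` at `i p` of the Christoffel symbols of `G`. -/
structure LocalSubmersion (i : F → E) (f : F → E') (l : F → E' →L[ℝ] F)
    (G : E → E →L[ℝ] E →L[ℝ] ℝ) (G' : E' → E' →L[ℝ] E' →L[ℝ] ℝ) (Γ : E →L[ℝ] E →L[ℝ] E)
    (p : F) : Prop where
  contDiff_i : ContDiffAt ℝ 2 i p
  contDiff_f : ContDiffAt ℝ 2 f p
  diff_l : DifferentiableAt ℝ l p
  diff_G : DifferentiableAt ℝ G (i p)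
  diff_G' : DifferentiableAt ℝ G' (f p)
  symm : ∀ u w, G (i p) u w = G (i p) w u
  symm' : ∀ u w, G' (f p) u w = G' (f p) w u
  nondeg' : ∀ u, (∀ w, G' (f p) u w = 0) → u = 0
  adjoint : ∀ᶠ q in 𝓝 p, ∀ w u,
    G (i q) (fderiv ℝ i q (l q w)) (fderiv ℝ i q u) = G' (f q) w (fderiv ℝ f q u)
  section_l : ∀ᶠ q in 𝓝 p, ∀ w, fderiv ℝ f q (l q w) = w
  torsionFree : ∀ u v, Γ u v = Γ v u
  metric : ∀ v u w, fderiv ℝ G (i p) v u w = G (i p) (Γ u v) w + G (i p) u (Γ w v)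

namespace LocalSubmersion

variable {i : F → E} {f : F → E'} {l : F → E' →L[ℝ] F}
    {G : E → E →L[ℝ] E →L[ℝ] ℝ} {G' : E' → E' →L[ℝ] E' →L[ℝ] ℝ} {Γ : E →L[ℝ] E →L[ℝ] E}
    {p : F}

lemma differentiableAt_ambientLift (h : LocalSubmersion i f l G G' Γ p) :
    DifferentiableAt ℝ (ambientLift i l) p :=
  ((h.contDiff_i.fderiv_right (m := 1) (by norm_num)).differentiableAt one_ne_zero).clm_comp
    h.diff_l

lemma fderiv_ambientLift (h : LocalSubmersion i f l G G' Γ p) (z : F) (w : E') :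
    fderiv ℝ (ambientLift i l) p z w
      = fderiv ℝ (fderiv ℝ i) p z (l p w) + fderiv ℝ i p (fderiv ℝ l p z w) := by
  have hdi := (h.contDiff_i.fderiv_right (m := 1) (by norm_num)).differentiableAt one_ne_zero
  have := (hdi.hasFDerivAt.clm_comp h.diff_l.hasFDerivAt).fderiv
  refine (congr($this z w)).trans ?_
  simp [add_comm]

/-- The adjoint relation is tested on a second horizontal lift. It is needed near `p`, not only at
`p`, because `metric_pullback` differentiates it. -/
lemma isometry (h : LocalSubmersion i f l G G' Γ p) : ∀ᶠ q in 𝓝 p, ∀ u w,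
    G (i q) (ambientLift i l q u) (ambientLift i l q w) = G' (f q) u w := by
  filter_upwards [h.adjoint, h.section_l] with q h1 h2 u w
  have := h1 u (l q w)
  rwa [h2] at this

/-- Constant fields on the base commute, and the bracket of their horizontal lifts is projectable to
their bracket, which is zero. -/
lemma bracket_vertical (h : LocalSubmersion i f l G G' Γ p) (u w : E') :
    fderiv ℝ f p (fderiv ℝ l p (l p w) u - fderiv ℝ l p (l p u) w) = 0 := by
  have hdf := (h.contDiff_f.fderiv_right (m := 1) (by norm_num)).differentiableAt one_ne_zero
  -- This differentiates `f_* ∘ l = id`; symmetry of the second derivative of `f` then removes the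
  -- second-order terms.
  have key (z : F) (u : E') :
      fderiv ℝ (fderiv ℝ f) p z (l p u) + fderiv ℝ f p (fderiv ℝ l p z u) = 0 := by
    have h1 : (fun q ↦ fderiv ℝ f q ∘L l q) =ᶠ[𝓝 p] fun _ ↦ ContinuousLinearMap.id ℝ E' := by
      filter_upwards [h.section_l] with q hq
      ext w
      exact hq w
    have h2 := (hdf.hasFDerivAt.clm_comp h.diff_l.hasFDerivAt).fderiv
    rw [h1.fderiv_eq] at h2
    have h3 := congr($h2 z u)
    simpa [add_comm] using h3.symm
  have hs := h.contDiff_f.isSymmSndFDerivAt (by simp) (l p w) (l p u)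
  have k1 := key (l p w) u
  have k2 := key (l p u) w
  rw [map_sub, sub_eq_zero]
  rw [hs] at k1
  exact add_left_cancel (k1.trans k2.symm)

/-- The isometry relation is differentiated in the horizontal direction `l p v`, and metricity of
`Γ` replaces the derivative of `G`. Both bracketed terms are the ambient covariant derivatives of
the lifts. -/
lemma metric_pullback (h : LocalSubmersion i f l G G' Γ p) (v u w : E') :
    fderiv ℝ G' (f p) v u w
      = G (i p) (fderiv ℝ (ambientLift i l) p (l p v) u
          + Γ (ambientLift i l p u) (ambientLift i l p v)) (ambientLift i l p w)
        + G (i p) (ambientLift i l p u) (fderiv ℝ (ambientLift i l) p (l p v) w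
          + Γ (ambientLift i l p w) (ambientLift i l p v)) := by
  have hL := h.differentiableAt_ambientLift
  have hL' (x : E') (z : F) : fderiv ℝ (fun q ↦ ambientLift i l q x) p z
      = fderiv ℝ (ambientLift i l) p z x := by
    rw [fderiv_clm_apply hL (differentiableAt_const x)]
    simp
  have h1 : (fun q ↦ G (i q) (ambientLift i l q u) (ambientLift i l q w))
      =ᶠ[𝓝 p] fun q ↦ G' (f q) u w := h.isometry.mono fun q hq ↦ hq u w
  have hi := h.contDiff_i.differentiableAt two_ne_zero
  have hf := h.contDiff_f.differentiableAt two_ne_zero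
  have h2 := fderiv_bilinear_comp_apply (z := l p v) h.diff_G hi
    (hL.clm_apply (differentiableAt_const u)) (hL.clm_apply (differentiableAt_const w))
  have h3 := fderiv_bilinear_comp_apply (z := l p v) (i := f) h.diff_G' hf
    (differentiableAt_const u) (differentiableAt_const w)
  rw [h1.fderiv_eq, h3, hL', hL', h.section_l.self_of_nhds] at h2
  simp only [fderiv_fun_const, Pi.zero_apply, zero_apply, map_zero, add_zero]
    at h2
  rw [h2, show fderiv ℝ i p (l p v) = ambientLift i l p v from rfl, h.metric]
  simp only [map_add, add_apply]
  ring

end LocalSubmersion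

end Local

/-! ### Projecting the ambient connection to the base. -/

section Local

open Filter Topology

variable {F E E' : Type*} [NormedAddCommGroup F] [NormedSpace ℝ F]
  [NormedAddCommGroup E] [NormedSpace ℝ E]
  [NormedAddCommGroup E'] [NormedSpace ℝ E'] [FiniteDimensional ℝ E']

/-- The adjoint of a linear map into a space with a bilinear form, with respect to a nondegenerate
form on its source. -/
lemma exists_adjoint_of_nondegenerate [FiniteDimensional ℝ E]
    (B : E →L[ℝ] E →L[ℝ] ℝ) (B' : E' →L[ℝ] E' →L[ℝ] ℝ)
    (hB' : ∀ u, (∀ w, B' u w = 0) → u = 0) (T : E' →L[ℝ] E) :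
    ∃ R : E →L[ℝ] E', ∀ e w, B' (R e) w = B e (T w) := by
  let b : E' →ₗ[ℝ] Module.Dual ℝ E' :=
    { toFun := fun u ↦ (B' u).toLinearMap
      map_add' := fun u v ↦ by ext; simp
      map_smul' := fun c v ↦ by ext; simp }
  have hinj : Function.Injective b := by
    refine (injective_iff_map_eq_zero b).2 fun u hu ↦ hB' u fun w ↦ congr($hu w)
  have hsurj : Function.Surjective b :=
    (LinearMap.injective_iff_surjective_of_finrank_eq_finrank
      (Subspace.dual_finrank_eq (K := ℝ) (V := E')).symm).1 hinj
  obtain ⟨s, hs⟩ := b.exists_rightInverse_of_surjective (LinearMap.range_eq_top.2 hsurj)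
  let c : E →ₗ[ℝ] Module.Dual ℝ E' :=
    { toFun := fun e ↦ ((B e) ∘L T).toLinearMap
      map_add' := fun u v ↦ by ext; simp
      map_smul' := fun c v ↦ by ext; simp }
  exact ⟨LinearMap.toContinuousLinearMap (s ∘ₗ c), fun e w ↦
    congr($(LinearMap.congr_fun hs (c e)) w)⟩

namespace LocalSubmersion

variable {i : F → E} {f : F → E'} {l : F → E' →L[ℝ] F}
    {G : E → E →L[ℝ] E →L[ℝ] ℝ} {G' : E' → E' →L[ℝ] E' →L[ℝ] ℝ} {Γ : E →L[ℝ] E →L[ℝ] E}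
    {p : F}

/-- The derivative `∇_v w` of the ambient horizontal lift of the constant field `w` in the
direction of the horizontal lift of `v`. -/
lemma exists_ambient_derivative (i : F → E) (l : F → E' →L[ℝ] F) (Γ : E →L[ℝ] E →L[ℝ] E) (p : F)
    (R : E →L[ℝ] E') : ∃ Γ' : E' →L[ℝ] E' →L[ℝ] E', ∀ w v,
      Γ' w v = R (fderiv ℝ (ambientLift i l) p (l p v) w
        + Γ (ambientLift i l p w) (ambientLift i l p v)) :=
  ⟨(LinearMap.mk₂ ℝ (fun w v ↦ R (fderiv ℝ (ambientLift i l) p (l p v) w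
        + Γ (ambientLift i l p w) (ambientLift i l p v)))
      (by intros; simp only [map_add, add_apply]; abel)
      (by intros; simp only [map_add, map_smul, smul_apply, smul_add])
      (by intros; simp only [map_add, add_apply]; abel)
      (by intros; simp only [map_add, map_smul, smul_apply, smul_add])).toContinuousBilinearMap,
    fun _ _ ↦ rfl⟩

/-- The projection to the base of the Christoffel symbols of the ambient space: it is symmetric,
metric, and for every endomorphism field `A` of the base that lifts to a combination of fields
`J β` spanning a parallel family, the covariant derivative of `A` is a combination of the
corresponding endomorphisms `J' β` of the base. -/
theorem exists_christoffel [FiniteDimensional ℝ E] {n : Type*} [Fintype n]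
    (h : LocalSubmersion i f l G G' Γ p)
    (J : n → E → E →L[ℝ] E) (J' : n → E' →L[ℝ] E')
    (hJ : ∀ β, DifferentiableAt ℝ (J β) (i p))
    (hJpar : ∀ β v, ∃ c : n → ℝ, ∀ u,
      fderiv ℝ (J β) (i p) v u + Γ (J β (i p) u) v - J β (i p) (Γ u v)
        = ∑ γ, c γ • J γ (i p) u)
    (hskew : ∀ β u w, G (i p) (J β (i p) u) w = -G (i p) u (J β (i p) w))
    (hskew' : ∀ β u w, G' (f p) (J' β u) w = -G' (f p) u (J' β w))
    (hJJ' : ∀ β w, J β (i p) (ambientLift i l p w) = ambientLift i l p (J' β w))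
    (hli : LinearIndependent ℝ J') :
    ∃ Γ' : E' →L[ℝ] E' →L[ℝ] E', (∀ u v, Γ' u v = Γ' v u) ∧
      (∀ v u w, fderiv ℝ G' (f p) v u w = G' (f p) (Γ' u v) w + G' (f p) u (Γ' w v)) ∧
      ∀ A : E' → E' →L[ℝ] E', DifferentiableAt ℝ A (f p) →
        (∀ᶠ q in 𝓝 p, ∃ c : n → ℝ, ∀ w,
          ambientLift i l q (A (f q) w) = ∑ β, c β • J β (i q) (ambientLift i l q w)) →
        ∀ v, ∃ c : n → ℝ, ∀ w, fderiv ℝ A (f p) v w + Γ' (A (f p) w) v - A (f p) (Γ' w v)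
          = ∑ β, c β • J' β w := by
  -- `R` kills the orthogonal complement of the range of `L` and inverts `L` on that range; `Γ'` is
  -- the projected ambient derivative.
  obtain ⟨R, hR⟩ := exists_adjoint_of_nondegenerate (G (i p)) (G' (f p)) h.nondeg'
    (ambientLift i l p)
  obtain ⟨Γ', hΓ'⟩ := exists_ambient_derivative i l Γ p R
  set L := ambientLift i l with hL_def
  have hLd : DifferentiableAt ℝ L p := h.differentiableAt_ambientLift
  have ext' (u v : E') (huv : ∀ w, G' (f p) u w = G' (f p) v w) : u = v := by
    rw [← sub_eq_zero]
    refine h.nondeg' _ fun w ↦ ?_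
    rw [map_sub, sub_apply, huv, sub_self]
  have hRL (w : E') : R (L p w) = w := ext' _ _ fun x ↦ by
    rw [hR, h.isometry.self_of_nhds]
  -- This is the adjoint of `J L = L J'`, both endomorphisms being skew.
  have hRJ (β : n) (e : E) : R (J β (i p) e) = J' β (R e) := ext' _ _ fun x ↦ by
    rw [hR, hskew, hJJ', hskew', hR]
  have hi := h.contDiff_i.differentiableAt two_ne_zero
  have hf := h.contDiff_f.differentiableAt two_ne_zero
  refine ⟨Γ', fun u v ↦ ext' _ _ fun x ↦ ?_, fun v u w ↦ ?_, fun A hA hlift v ↦ ?_⟩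
  -- Symmetry of `Γ` and of the second derivative of `i` leaves only the image of the vertical
  -- bracket, orthogonal to every horizontal lift.
  · rw [← sub_eq_zero, hΓ', hΓ', hR, hR, ← sub_apply, ← map_sub, h.fderiv_ambientLift,
      h.fderiv_ambientLift, h.torsionFree (L p u)]
    have hs := h.contDiff_i.isSymmSndFDerivAt (by simp) (l p v) (l p u)
    have h1 : fderiv ℝ (fderiv ℝ i) p (l p v) (l p u) + fderiv ℝ i p (fderiv ℝ l p (l p v) u)
        + Γ (L p v) (L p u) - (fderiv ℝ (fderiv ℝ i) p (l p u) (l p v)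
          + fderiv ℝ i p (fderiv ℝ l p (l p u) v) + Γ (L p v) (L p u))
        = fderiv ℝ i p (fderiv ℝ l p (l p v) u - fderiv ℝ l p (l p u) v) := by
      rw [hs, map_sub]
      abel
    rw [h1, h.symm]
    exact (h.adjoint.self_of_nhds x _).trans (by rw [h.bracket_vertical, map_zero])
  · rw [h.metric_pullback, hΓ', hΓ', hR, h.symm' u, hR, h.symm (L p u)]
  -- `B q` sends coefficients to the combination of the `J β ∘ L`. It is injective at `p` because
  -- `R` carries it there to the independent `J' β`; this makes the coefficients of `L ∘ A`
  -- differentiable.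
  · let B : F → (n → ℝ) →L[ℝ] (E' →L[ℝ] E) := fun q ↦
      ∑ β, (ContinuousLinearMap.proj (R := ℝ) (φ := fun _ : n ↦ ℝ) β).smulRight (J β (i q) ∘L L q)
    have hBapply (q : F) (c : n → ℝ) (w : E') : B q c w = ∑ β, c β • J β (i q) (L q w) := by
      simp [B]
    have hJL (β : n) : DifferentiableAt ℝ (fun q ↦ J β (i q) ∘L L q) p :=
      ((hJ β).comp p hi).clm_comp hLd
    have hAf := hA.comp p hf
    obtain ⟨c, hc, hc'⟩ := exists_differentiableAt_of_mem_range
      (B := B) (a := fun q ↦ L q ∘L A (f q)) (p := p)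
      (by
        refine DifferentiableAt.fun_sum fun β _ ↦ ?_
        exact (ContinuousLinearMap.smulRightL ℝ (n → ℝ) (E' →L[ℝ] E)
          (ContinuousLinearMap.proj (R := ℝ) (φ := fun _ : n ↦ ℝ) β)).differentiableAt.comp p
            (hJL β))
      (hLd.clm_comp hAf)
      (by
        refine (injective_iff_map_eq_zero _).2 fun c hc ↦ ?_
        refine funext (Fintype.linearIndependent_iff.1 hli c ?_)
        ext w
        have h1 := congr(R ($hc w))
        rw [hBapply] at h1
        simpa [hJJ', hRL] using h1)
      (by
        filter_upwards [hlift] with q ⟨c, hc⟩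
        refine ⟨c, ?_⟩
        ext w
        rw [hBapply]
        exact hc w)
    choose d hd using fun β ↦ hJpar β (L p v)
    -- By the product rule, the coefficients of the derivative are those of `dc` plus `c` times the
    -- connection matrix `d` of the frame `J`.
    refine ⟨fun β ↦ fderiv ℝ c p (l p v) β + ∑ γ, c p γ * d γ β, fun w ↦ ?_⟩
    have e1 : (fun q ↦ L q (A (f q) w)) =ᶠ[𝓝 p] fun q ↦ ∑ β, c q β • J β (i q) (L q w) := by
      filter_upwards [hc'] with q hq
      rw [← hBapply, ← hq]
      rfl
    have hz : fderiv ℝ f p (l p v) = v := h.section_l.self_of_nhds v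
    have e2 : fderiv ℝ (fun q ↦ L q (A (f q) w)) p (l p v)
        = fderiv ℝ L p (l p v) (A (f p) w) + L p (fderiv ℝ A (f p) v w) := by
      have := (hLd.hasFDerivAt.clm_apply ((hA.hasFDerivAt.comp p hf.hasFDerivAt).clm_apply
        (hasFDerivAt_const w p))).fderiv
      refine (congr($this (l p v))).trans ?_
      simp [hz, add_comm]
    have e3 : fderiv ℝ (fun q ↦ ∑ β, c q β • J β (i q) (L q w)) p (l p v)
        = ∑ β, (fderiv ℝ c p (l p v) β • J β (i p) (L p w)
          + c p β • (fderiv ℝ (J β) (i p) (L p v) (L p w)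
            + J β (i p) (fderiv ℝ L p (l p v) w))) := by
      have := (HasFDerivAt.fun_sum (u := Finset.univ) fun β _ ↦
        ((hasFDerivAt_apply β (c p)).comp p hc.hasFDerivAt).smul
          (((hJ β).hasFDerivAt.comp p hi.hasFDerivAt).clm_apply
            (hLd.hasFDerivAt.clm_apply (hasFDerivAt_const w p)))).fderiv
      refine (congr($this (l p v))).trans ?_
      simp only [sum_apply]
      refine Finset.sum_congr rfl fun β _ ↦ ?_
      simp [L, ambientLift, add_comm]
    have hLA (u : E') : L p (A (f p) u) = ∑ β, c p β • J β (i p) (L p u) := by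
      rw [← hBapply, ← hc'.self_of_nhds]
      rfl
    have hA' (u : E') : A (f p) u = ∑ β, c p β • J' β u := by
      rw [← hRL (A (f p) u), hLA]
      simp [hJJ', hRL]
    -- Both expressions for the derivative of `L (A w)` are projected to the base. Below, the two
    -- terms containing derivatives of `L` cancel against those in `Γ'`, and `e5` identifies what
    -- remains.
    have e4 : R (fderiv ℝ (fun q ↦ L q (A (f q) w)) p (l p v))
        = R (fderiv ℝ (fun q ↦ ∑ β, c q β • J β (i q) (L q w)) p (l p v)) := by
      rw [e1.fderiv_eq]
    rw [e2, e3] at e4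
    have e5 (β : n) : R (fderiv ℝ (J β) (i p) (L p v) (L p w)) + R (Γ (J β (i p) (L p w)) (L p v))
        - J' β (R (Γ (L p w) (L p v))) = ∑ γ, d β γ • J' γ w := by
      have := congr(R $(hd β (L p w)))
      simpa [hRJ, hJJ', hRL] using this
    have e6 : ∑ β, (fderiv ℝ c p (l p v) β + ∑ γ, c p γ * d γ β) • J' β w
        = ∑ β, (fderiv ℝ c p (l p v) β • J' β w + c p β • ∑ γ, d β γ • J' γ w) := by
      simp only [add_smul, Finset.sum_add_distrib, Finset.sum_smul, Finset.smul_sum, mul_smul]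
      rw [Finset.sum_comm]
    have e7 : R (Γ (L p (A (f p) w)) (L p v))
        = ∑ β, c p β • R (Γ (J β (i p) (L p w)) (L p v)) := by
      rw [hLA]
      simp
    simp only [map_add, map_sum, map_smul, hRL, hRJ, hJJ' _ w] at e4
    rw [e6, hΓ', hΓ', hA' (R _), map_add, map_add, e7]
    simp_rw [← e5]
    have e8 : fderiv ℝ A (f p) v w = ∑ β, (fderiv ℝ c p (l p v) β • J' β w
        + c p β • (R (fderiv ℝ (J β) (i p) (L p v) (L p w))
          + J' β (R (fderiv ℝ L p (l p v) w)))) - R (fderiv ℝ L p (l p v) (A (f p) w)) := by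
      rw [← e4]
      abel
    rw [e8, ← add_assoc, sub_add_cancel, ← Finset.sum_add_distrib, ← Finset.sum_sub_distrib]
    refine Finset.sum_congr rfl fun β _ ↦ ?_
    rw [map_add]
    module

end LocalSubmersion

end Local

/-! ### Vector fields and covariant derivatives in preferred charts. -/

section Charts

open Filter Topology

variable {E : Type*} [NormedAddCommGroup E] [NormedSpace ℝ E]
  {M : Type*} [TopologicalSpace M] [ChartedSpace E M]

/-- The preferred chart at `x`, as a map to the model space. -/
def coord (x : M) : M → E := extChartAt 𝓘(ℝ, E) x

/-- The inverse of the preferred chart at `x`. -/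
def coordInv (x : M) : E → M := (extChartAt 𝓘(ℝ, E) x).symm

lemma coordInv_coord {x y : M} (hy : y ∈ (chartAt E x).source) :
    coordInv (E := E) x (coord x y) = y :=
  (extChartAt 𝓘(ℝ, E) x).left_inv (by simpa using hy)

@[simp] lemma coordInv_coord_self (x : M) : coordInv (E := E) x (coord x x) = x :=
  coordInv_coord (mem_chart_source E x)

lemma eventually_coordInv_mem_source (x : M) :
    ∀ᶠ e in 𝓝 (coord (E := E) x x), coordInv x e ∈ (chartAt E x).source := by
  filter_upwards [extChartAt_target_mem_nhds (I := 𝓘(ℝ, E)) x] with e he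
  exact extChartAt_source (I := 𝓘(ℝ, E)) x ▸ (extChartAt 𝓘(ℝ, E) x).map_target he

lemma eventually_coord_coordInv (x : M) :
    ∀ᶠ e in 𝓝 (coord (E := E) x x), coord x (coordInv x e) = e := by
  filter_upwards [extChartAt_target_mem_nhds (I := 𝓘(ℝ, E)) x] with e he
  exact (extChartAt 𝓘(ℝ, E) x).right_inv he

lemma tendsto_coordInv (x : M) :
    Tendsto (coordInv x) (𝓝 (coord (E := E) x x)) (𝓝 x) := by
  have := continuousAt_extChartAt_symm (I := 𝓘(ℝ, E)) x
  rwa [ContinuousAt, extChartAt_to_inv] at this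

lemma eventuallyEq_comp_coordInv_comp {W : Type*} (u : M → W) (x : M) :
    u =ᶠ[𝓝 x] (u ∘ coordInv (E := E) x) ∘ coord x := by
  filter_upwards [chart_source_mem_nhds E x] with y hy
  simp [coordInv_coord hy]

variable {W : Type*} [NormedAddCommGroup W] [NormedSpace ℝ W] [IsManifold 𝓘(ℝ, E) ∞ M]

/-- The coordinates of tangent vectors at `y` in the preferred chart at `x`. -/
def toModel (x y : M) : TangentSpace 𝓘(ℝ, E) y →L[ℝ] E :=
  (trivializationAt E (TangentSpace 𝓘(ℝ, E)) x).continuousLinearMapAt ℝ y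

/-- The tangent vectors at `y` with given coordinates in the preferred chart at `x`. -/
def ofModel (x y : M) : E →L[ℝ] TangentSpace 𝓘(ℝ, E) y :=
  (trivializationAt E (TangentSpace 𝓘(ℝ, E)) x).symmL ℝ y

lemma toModel_ofModel {x y : M} (hy : y ∈ (chartAt E x).source) (v : E) :
    toModel x y (ofModel x y v) = v :=
  (trivializationAt E (TangentSpace 𝓘(ℝ, E)) x).continuousLinearMapAt_symmL (R := ℝ) hy v

lemma ofModel_toModel {x y : M} (hy : y ∈ (chartAt E x).source) (v : TangentSpace 𝓘(ℝ, E) y) :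
    ofModel x y (toModel x y v) = v :=
  (trivializationAt E (TangentSpace 𝓘(ℝ, E)) x).symmL_continuousLinearMapAt (R := ℝ) hy v

lemma toModel_injective {x y : M} (hy : y ∈ (chartAt E x).source) :
    Function.Injective (toModel (E := E) x y) :=
  Function.LeftInverse.injective (ofModel_toModel hy)

@[simp] lemma toModel_ofModel_self (x : M) (v : E) : toModel x x (ofModel x x v) = v :=
  toModel_ofModel (mem_chart_source E x) v

@[simp] lemma ofModel_toModel_self (x : M) (v : TangentSpace 𝓘(ℝ, E) x) :
    ofModel x x (toModel x x v) = v :=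
  ofModel_toModel (mem_chart_source E x) v

lemma mdifferentiableAt_coord {x y : M} (hy : y ∈ (chartAt E x).source) :
    MDifferentiableAt 𝓘(ℝ, E) 𝓘(ℝ, E) (coord (E := E) x) y :=
  mdifferentiableAt_extChartAt hy

lemma toModel_eq_mfderiv {x y : M} (hy : y ∈ (chartAt E x).source) (v : TangentSpace 𝓘(ℝ, E) y) :
    toModel x y v = mfderiv 𝓘(ℝ, E) 𝓘(ℝ, E) (coord (E := E) x) y v :=
  congr($(TangentBundle.continuousLinearMapAt_trivializationAt (I := 𝓘(ℝ, E)) hy) v)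

lemma mdifferentiableAt_iff_comp_coordInv (u : M → W) (x : M) :
    MDifferentiableAt 𝓘(ℝ, E) 𝓘(ℝ, W) u x
      ↔ DifferentiableAt ℝ (u ∘ coordInv x) (coord (E := E) x x) := by
  constructor
  · intro h
    have h' := h.differentiableWithinAt_writtenInExtChartAt
    rw [ModelWithCorners.range_eq_univ, differentiableWithinAt_univ] at h'
    exact h'
  · intro h
    refine MDifferentiableAt.congr_of_eventuallyEq ?_ (eventuallyEq_comp_coordInv_comp (E := E) u x)
    exact h.mdifferentiableAt.comp x (mdifferentiableAt_coord (mem_chart_source E x))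

lemma mvfderiv_eq_fderiv_comp_coordInv {u : M → W} {x : M}
    (hu : MDifferentiableAt 𝓘(ℝ, E) 𝓘(ℝ, W) u x) (v : TangentSpace 𝓘(ℝ, E) x) :
    (d% u x) v = fderiv ℝ (u ∘ coordInv x) (coord x x) (toModel x x v) := by
  have hd := (mdifferentiableAt_iff_comp_coordInv u x).1 hu
  have h1 := mfderiv_comp (I := 𝓘(ℝ, E)) (I' := 𝓘(ℝ, E)) (I'' := 𝓘(ℝ, W)) x hd.mdifferentiableAt
    (mdifferentiableAt_coord (mem_chart_source E x))
  rw [← (eventuallyEq_comp_coordInv_comp u x).mfderiv_eq, mfderiv_eq_fderiv] at h1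
  rw [toModel_eq_mfderiv (mem_chart_source E x)]
  exact congr($h1 v)

/-- The coordinate expression of a vector field in the preferred chart at `x`. -/
def coordField (x : M) (Y : ∀ y : M, TangentSpace 𝓘(ℝ, E) y) (e : E) : E :=
  toModel x (coordInv x e) (Y (coordInv x e))

@[simp] lemma coordField_self (x : M) (Y : ∀ y : M, TangentSpace 𝓘(ℝ, E) y) :
    coordField x Y (coord x x) = toModel x x (Y x) := by
  -- The fibre depends on the point, so `coordInv x (coord x x) = x` cannot be rewritten in place;
  -- the point is generalised first and then substituted.
  have (z : M) (hz : z = x) : toModel x z (Y z) = toModel x x (Y x) := by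
    subst hz
    rfl
  exact this _ (coordInv_coord_self x)

lemma coordField_add (x : M) (Y Z : ∀ y : M, TangentSpace 𝓘(ℝ, E) y) :
    coordField x (Y + Z) = coordField x Y + coordField x Z := by
  ext e
  exact map_add (toModel x (coordInv x e)) _ _

lemma coordField_smul (x : M) (u : M → ℝ) (Y : ∀ y : M, TangentSpace 𝓘(ℝ, E) y) :
    coordField x (u • Y) = (u ∘ coordInv (E := E) x) • coordField x Y := by
  ext e
  exact map_smul (toModel x (coordInv x e)) _ _

lemma mdifferentiableAt_iff_coordField (x : M) (Y : ∀ y : M, TangentSpace 𝓘(ℝ, E) y) :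
    MDiffAt (T% Y) x ↔ DifferentiableAt ℝ (coordField x Y) (coord x x) := by
  rw [mdifferentiableAt_section, mdifferentiableAt_iff_comp_coordInv]
  refine Filter.EventuallyEq.differentiableAt_iff ?_
  filter_upwards [eventually_coordInv_mem_source (E := E) x] with e he
  exact congr($(Bundle.Trivialization.coe_linearMapAt_of_mem (R := ℝ) (b := coordInv x e)
    (trivializationAt E (TangentSpace 𝓘(ℝ, E)) x) he) (Y (coordInv x e))).symm

variable (E M) in
/-- The covariant derivative that at each point is the derivative in the preferred chart at that
point. -/
def chartCov : CovariantDerivative 𝓘(ℝ, E) E (TangentSpace 𝓘(ℝ, E) : M → Type _) where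
  -- Every point uses its own chart, so no regularity in `x` results; additivity and the Leibniz
  -- rule are pointwise.
  toFun Y x := ofModel x x ∘L fderiv ℝ (coordField x Y) (coord x x) ∘L toModel x x
  isCovariantDerivativeOnUniv :=
    { add := by
        intro Y Z x hY hZ _
        rw [mdifferentiableAt_iff_coordField] at hY hZ
        ext v
        simp [coordField_add, fderiv_add hY hZ]
      leibniz := by
        intro Y u x hY hu _
        ext v
        have hd := (mdifferentiableAt_iff_comp_coordInv u x).1 hu
        rw [mdifferentiableAt_iff_coordField] at hY
        simp [coordField_smul, fderiv_smul hd hY, mvfderiv_eq_fderiv_comp_coordInv hu v] }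

lemma toModel_chartCov (Y : ∀ y : M, TangentSpace 𝓘(ℝ, E) y) (x : M) (v : TangentSpace 𝓘(ℝ, E) x) :
    toModel x x (chartCov E M Y x v)
      = fderiv ℝ (coordField x Y) (coord x x) (toModel x x v) :=
  toModel_ofModel_self x _

end Charts

/-! ### Brackets, endomorphism fields and metrics in coordinates. -/

section Charts

open Filter Topology

variable {E : Type*} [NormedAddCommGroup E] [NormedSpace ℝ E]
  {M : Type*} [TopologicalSpace M] [ChartedSpace E M] [IsManifold 𝓘(ℝ, E) ∞ M]

lemma inverse_ofModel {x y : M} (hy : y ∈ (chartAt E x).source) :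
    (ofModel (E := E) x y).inverse = toModel x y :=
  ContinuousLinearMap.inverse_eq (ContinuousLinearMap.ext (ofModel_toModel hy))
    (ContinuousLinearMap.ext (toModel_ofModel hy))

lemma inverse_toModel {x y : M} (hy : y ∈ (chartAt E x).source) :
    (toModel (E := E) x y).inverse = ofModel x y :=
  ContinuousLinearMap.inverse_eq (ContinuousLinearMap.ext (toModel_ofModel hy))
    (ContinuousLinearMap.ext (ofModel_toModel hy))

/-- `mlieBracket` is defined through these pulled-back fields; this identifies them with
`coordField`. -/
lemma mpullbackWithin_coordInv (x : M) (X : ∀ y : M, TangentSpace 𝓘(ℝ, E) y) :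
    VectorField.mpullbackWithin 𝓘(ℝ, E) 𝓘(ℝ, E) (extChartAt 𝓘(ℝ, E) x).symm X
        (Set.range 𝓘(ℝ, E)) =ᶠ[𝓝 (coord (E := E) x x)] coordField x X := by
  filter_upwards [eventually_coordInv_mem_source (E := E) x, eventually_coord_coordInv (E := E) x]
    with e he he'
  have h1 := TangentBundle.symmL_trivializationAt (I := 𝓘(ℝ, E)) he
  rw [show extChartAt 𝓘(ℝ, E) x (coordInv x e) = e from he'] at h1
  have h2 : @Eq (E →L[ℝ] TangentSpace 𝓘(ℝ, E) (coordInv (E := E) x e)) (ofModel x (coordInv x e))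
      (mfderivWithin 𝓘(ℝ, E) 𝓘(ℝ, E) (extChartAt 𝓘(ℝ, E) x).symm (Set.range 𝓘(ℝ, E)) e) := h1
  have h3 := congr($(inverse_ofModel he) (X (coordInv x e)))
  rw [h2] at h3
  exact h3

lemma toModel_mlieBracket [CompleteSpace E] (x : M) (X Y : ∀ y : M, TangentSpace 𝓘(ℝ, E) y) :
    toModel x x (VectorField.mlieBracket 𝓘(ℝ, E) X Y x)
      = fderiv ℝ (coordField x Y) (coord x x) (toModel x x (X x))
        - fderiv ℝ (coordField x X) (coord x x) (toModel x x (Y x)) := by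
  have hx := mem_chart_source E x
  let V (Z : ∀ y : M, TangentSpace 𝓘(ℝ, E) y) : E → E :=
    VectorField.mpullbackWithin 𝓘(ℝ, E) 𝓘(ℝ, E) (extChartAt 𝓘(ℝ, E) x).symm Z (Set.range 𝓘(ℝ, E))
  have h1 : VectorField.mlieBracket 𝓘(ℝ, E) X Y x
      = (toModel x x).inverse
        (VectorField.lieBracketWithin ℝ (V X) (V Y) (Set.univ ∩ Set.range 𝓘(ℝ, E))
          (coord x x)) := by
    rw [show toModel x x = mfderiv 𝓘(ℝ, E) 𝓘(ℝ, E) (coord (E := E) x) x from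
      ContinuousLinearMap.ext (toModel_eq_mfderiv hx)]
    rfl
  rw [h1, inverse_toModel hx, toModel_ofModel_self, ModelWithCorners.range_eq_univ,
    Set.univ_inter, VectorField.lieBracketWithin_univ,
    (mpullbackWithin_coordInv x X).lieBracket_vectorField_eq (mpullbackWithin_coordInv x Y),
    VectorField.lieBracket, coordField_self, coordField_self]

/-- The vector field with constant coordinates `u` in the preferred chart at `x`. -/
def constField (x : M) (u : E) (y : M) : TangentSpace 𝓘(ℝ, E) y := ofModel x y u

lemma coordField_constField (x : M) (u : E) :
    coordField x (constField x u) =ᶠ[𝓝 (coord x x)] fun _ ↦ u := by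
  filter_upwards [eventually_coordInv_mem_source (E := E) x] with e he
  exact toModel_ofModel he u

lemma mdifferentiableAt_constField (x : M) (u : E) : MDiffAt (T% (constField x u)) x := by
  rw [mdifferentiableAt_iff_coordField]
  exact (differentiableAt_const u).congr_of_eventuallyEq (coordField_constField x u)

/-- The coordinate expression of an endomorphism field in the preferred chart at `x`. -/
def coordEnd (x : M) (A : ∀ y : M, TangentSpace 𝓘(ℝ, E) y →L[ℝ] TangentSpace 𝓘(ℝ, E) y) (e : E) :
    E →L[ℝ] E :=
  toModel x (coordInv x e) ∘L A (coordInv x e) ∘L ofModel x (coordInv x e)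

lemma differentiableAt_coordEnd {x : M}
    {A : ∀ y : M, TangentSpace 𝓘(ℝ, E) y →L[ℝ] TangentSpace 𝓘(ℝ, E) y} {U : Set M}
    (hA : SmoothEndOn A U) (hU : IsOpen U) (hx : x ∈ U) :
    DifferentiableAt ℝ (coordEnd x A) (coord x x) := by
  have h1 := (hA.contMDiffAt (hU.mem_nhds hx)).mdifferentiableAt (by simp)
  have h2 := ((mdifferentiableAt_hom_bundle _).1 h1).2
  exact (mdifferentiableAt_iff_comp_coordInv _ x).1 h2

lemma coordField_apply_coordEnd (x : M)
    (A : ∀ y : M, TangentSpace 𝓘(ℝ, E) y →L[ℝ] TangentSpace 𝓘(ℝ, E) y)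
    (Y : ∀ y : M, TangentSpace 𝓘(ℝ, E) y) :
    coordField x (fun y ↦ A y (Y y))
      =ᶠ[𝓝 (coord x x)] fun e ↦ coordEnd x A e (coordField x Y e) := by
  filter_upwards [eventually_coordInv_mem_source (E := E) x] with e he
  simp [coordField, coordEnd, ofModel_toModel he]

@[simp] lemma coordEnd_self (x : M)
    (A : ∀ y : M, TangentSpace 𝓘(ℝ, E) y →L[ℝ] TangentSpace 𝓘(ℝ, E) y) (u : E) :
    coordEnd x A (coord x x) u = toModel x x (A x (ofModel x x u)) := by
  have (z : M) (hz : z = x) : toModel x z (A z (ofModel x z u))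
      = toModel x x (A x (ofModel x x u)) := by
    subst hz
    rfl
  exact this _ (coordInv_coord_self x)

namespace SemiRiemannianMetric

/-- The coordinate expression of a metric in the preferred chart at `x`. -/
def coordForm (g : SemiRiemannianMetric E M) (x : M) (e : E) : E →L[ℝ] E →L[ℝ] ℝ :=
  ContinuousLinearMap.inCoordinates E (TangentSpace 𝓘(ℝ, E)) (E →L[ℝ] ℝ)
    (fun y : M ↦ TangentSpace 𝓘(ℝ, E) y →L[ℝ] ℝ) x (coordInv x e) x (coordInv x e)
    (g.inner (coordInv x e))

lemma coordForm_apply (g : SemiRiemannianMetric E M) {x : M} {e : E}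
    (he : coordInv x e ∈ (chartAt E x).source) (u w : E) :
    g.coordForm x e u w
      = g.inner (coordInv x e) (ofModel x (coordInv x e) u) (ofModel x (coordInv x e) w) := by
  have := inCoordinates_apply_eq₂ (𝕜 := ℝ) (F₁ := E) (E₁ := fun y : M ↦ TangentSpace 𝓘(ℝ, E) y)
    (F₂ := E) (E₂ := fun y : M ↦ TangentSpace 𝓘(ℝ, E) y)
    (F₃ := ℝ) (E₃ := fun y : M ↦ ℝ)
    (x₀ := x) (x := coordInv x e) (ϕ := g.inner (coordInv x e)) (v := u) (w := w) he he
    (by simp)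
  rw [← (trivializationAt E (TangentSpace 𝓘(ℝ, E)) x).symmL_apply (R := ℝ) he,
    ← (trivializationAt E (TangentSpace 𝓘(ℝ, E)) x).symmL_apply (R := ℝ) he] at this
  exact this.trans
    (congr($(Bundle.Trivial.linearMapAt_trivialization ℝ M ℝ (coordInv (E := E) x e)) _))

lemma differentiableAt_coordForm (g : SemiRiemannianMetric E M) (x : M) :
    DifferentiableAt ℝ (g.coordForm x) (coord x x) := by
  have h1 := (g.contMDiff x).mdifferentiableAt (by simp)
  have h2 := ((mdifferentiableAt_hom_bundle _).1 h1).2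
  exact (mdifferentiableAt_iff_comp_coordInv _ x).1 h2

@[simp] lemma coordForm_self (g : SemiRiemannianMetric E M) (x : M) (u w : E) :
    g.coordForm x (coord x x) u w = g.inner x (ofModel x x u) (ofModel x x w) := by
  rw [coordForm_apply g (by simp)]
  have (z : M) (hz : z = x) : g.inner z (ofModel x z u) (ofModel x z w)
      = g.inner x (ofModel x x u) (ofModel x x w) := by
    subst hz
    rfl
  exact this _ (coordInv_coord_self x)

lemma inner_comp_coordInv (g : SemiRiemannianMetric E M) (x : M)
    (Y Z : ∀ y : M, TangentSpace 𝓘(ℝ, E) y) :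
    (fun y ↦ g.inner y (Y y) (Z y)) ∘ coordInv x
      =ᶠ[𝓝 (coord x x)] fun e ↦ g.coordForm x e (coordField x Y e) (coordField x Z e) := by
  filter_upwards [eventually_coordInv_mem_source (E := E) x] with e he
  simp [coordForm_apply g he, coordField, ofModel_toModel he]

end SemiRiemannianMetric

end Charts

/-! ### Christoffel symbols at the centre of a chart. -/

section Charts

open Filter Topology

variable {E : Type*} [NormedAddCommGroup E] [NormedSpace ℝ E]
  {M : Type*} [TopologicalSpace M] [ChartedSpace E M] [IsManifold 𝓘(ℝ, E) ∞ M]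

/-- `Γ` is the value at `x`, in the preferred chart, of the Christoffel symbols of `cov`. -/
def IsChristoffelAt (cov : CovariantDerivative 𝓘(ℝ, E) E (TangentSpace 𝓘(ℝ, E) : M → Type _))
    (x : M) (Γ : E →L[ℝ] E →L[ℝ] E) : Prop :=
  ∀ Y : ∀ y : M, TangentSpace 𝓘(ℝ, E) y, MDiffAt (T% Y) x → ∀ v : TangentSpace 𝓘(ℝ, E) x,
    toModel x x (cov Y x v) = fderiv ℝ (coordField x Y) (coord x x) (toModel x x v)
      + Γ (toModel x x (Y x)) (toModel x x v)

/-- The covariant derivative with given Christoffel symbols at the centre of each preferred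
chart. -/
def covOfChristoffel (Γ : M → E →L[ℝ] E →L[ℝ] E) :
    CovariantDerivative 𝓘(ℝ, E) E (TangentSpace 𝓘(ℝ, E) : M → Type _) :=
  (chartCov E M).addOneForm fun x ↦
    ContinuousLinearMap.postcomp (TangentSpace 𝓘(ℝ, E) x) (ofModel x x) ∘L
      ContinuousLinearMap.precomp E (toModel x x) ∘L Γ x ∘L toModel x x

lemma isChristoffelAt_covOfChristoffel (Γ : M → E →L[ℝ] E →L[ℝ] E) (x : M) :
    IsChristoffelAt (covOfChristoffel Γ) x (Γ x) := by
  intro Y _ v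
  have h1 : covOfChristoffel Γ Y x v = chartCov E M Y x v
      + ofModel x x (Γ x (toModel x x (Y x)) (toModel x x v)) := rfl
  rw [h1, map_add, toModel_chartCov, toModel_ofModel_self]

/-- The difference of two covariant derivatives is tensorial, and `chartCov` has zero symbols at the
centre of each chart. -/
lemma exists_isChristoffelAt [FiniteDimensional ℝ E]
    (cov : CovariantDerivative 𝓘(ℝ, E) E (TangentSpace 𝓘(ℝ, E) : M → Type _)) (x : M) :
    ∃ Γ : E →L[ℝ] E →L[ℝ] E, IsChristoffelAt cov x Γ := by
  refine ⟨ContinuousLinearMap.postcomp E (toModel x x) ∘L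
      ContinuousLinearMap.precomp (TangentSpace 𝓘(ℝ, E) x) (ofModel x x) ∘L
      cov.difference (chartCov E M) x ∘L ofModel x x, fun Y hY v ↦ ?_⟩
  have h1 : cov.difference (chartCov E M) x (Y x) = cov Y x - chartCov E M Y x :=
    IsCovariantDerivativeOn.difference_apply (s := Set.univ) cov.isCovariantDerivativeOnUniv
      (chartCov E M).isCovariantDerivativeOnUniv (Set.mem_univ x) hY
  have h2 := congr(toModel x x ($h1 v))
  rw [sub_apply, map_sub, toModel_chartCov, eq_sub_iff_add_eq'] at h2
  rw [← h2]
  simp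

namespace IsChristoffelAt

variable {cov : CovariantDerivative 𝓘(ℝ, E) E (TangentSpace 𝓘(ℝ, E) : M → Type _)}
  {x : M} {Γ : E →L[ℝ] E →L[ℝ] E}

lemma toModel_constField (h : IsChristoffelAt cov x Γ) (u : E) (v : TangentSpace 𝓘(ℝ, E) x) :
    toModel x x (cov (constField x u) x v) = Γ u (toModel x x v) := by
  rw [h _ (mdifferentiableAt_constField x u), (coordField_constField x u).fderiv_eq,
    ← coordField_self, (coordField_constField x u).self_of_nhds]
  simp

lemma torsion_apply [FiniteDimensional ℝ E] (h : IsChristoffelAt cov x Γ)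
    {X Y : ∀ y : M, TangentSpace 𝓘(ℝ, E) y} (hX : MDiffAt (T% X) x) (hY : MDiffAt (T% Y) x) :
    haveI := FiniteDimensional.complete ℝ E
    toModel x x (cov.torsion x (X x) (Y x)) = Γ (toModel x x (Y x)) (toModel x x (X x))
      - Γ (toModel x x (X x)) (toModel x x (Y x)) := by
  have := FiniteDimensional.complete ℝ E
  rw [cov.torsion_apply hX hY, map_sub, map_sub, toModel_mlieBracket, h X hX, h Y hY]
  abel

/-- Torsion is tensorial, so fields with constant coordinates detect it. -/
lemma torsion_eq_zero_iff [FiniteDimensional ℝ E] (h : IsChristoffelAt cov x Γ) :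
    haveI := FiniteDimensional.complete ℝ E
    cov.torsion x = 0 ↔ ∀ u v, Γ u v = Γ v u := by
  have := FiniteDimensional.complete ℝ E
  have key (u v : TangentSpace 𝓘(ℝ, E) x) : toModel x x (cov.torsion x u v)
      = Γ (toModel x x v) (toModel x x u) - Γ (toModel x x u) (toModel x x v) := by
    have := h.torsion_apply (mdifferentiableAt_constField x (toModel x x u))
      (mdifferentiableAt_constField x (toModel x x v))
    simpa [constField] using this
  constructor
  · intro h0 u v
    have := key (ofModel x x v) (ofModel x x u)
    rw [h0] at this
    simpa [sub_eq_zero, eq_comm (a := (0 : E))] using this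
  · intro h0
    ext u v
    refine toModel_injective (mem_chart_source E x) ?_
    rw [key, h0, sub_self]
    simp

lemma mvfderiv_inner (g : SemiRiemannianMetric E M) {Y Z : ∀ y : M, TangentSpace 𝓘(ℝ, E) y}
    (hY : MDiffAt (T% Y) x) (hZ : MDiffAt (T% Z) x) (v : TangentSpace 𝓘(ℝ, E) x) :
    (d% (fun y ↦ g.inner y (Y y) (Z y)) x) v
      = fderiv ℝ (g.coordForm x) (coord x x) (toModel x x v) (toModel x x (Y x)) (toModel x x (Z x))
        + g.coordForm x (coord x x) (fderiv ℝ (coordField x Y) (coord x x) (toModel x x v))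
          (toModel x x (Z x))
        + g.coordForm x (coord x x) (toModel x x (Y x))
          (fderiv ℝ (coordField x Z) (coord x x) (toModel x x v)) := by
  have hg := g.differentiableAt_coordForm x
  rw [mdifferentiableAt_iff_coordField] at hY hZ
  have h1 : MDifferentiableAt 𝓘(ℝ, E) 𝓘(ℝ, ℝ) (fun y ↦ g.inner y (Y y) (Z y)) x := by
    rw [mdifferentiableAt_iff_comp_coordInv]
    exact ((hg.clm_apply hY).clm_apply hZ).congr_of_eventuallyEq (g.inner_comp_coordInv x Y Z)
  rw [mvfderiv_eq_fderiv_comp_coordInv h1, (g.inner_comp_coordInv x Y Z).fderiv_eq]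
  have := fderiv_bilinear_comp_apply (i := id) (p := coord x x) hg differentiableAt_id hY hZ (toModel x x v)
  simpa using this

/-- Constant-coordinate fields give one direction. In the other, the derivatives of `Y` and `Z` on
both sides match by the product rule. -/
lemma compatible_iff (h : IsChristoffelAt cov x Γ) (g : SemiRiemannianMetric E M) :
    (∀ (v : TangentSpace 𝓘(ℝ, E) x) (Y Z : ∀ y : M, TangentSpace 𝓘(ℝ, E) y),
      MDiffAt (T% Y) x → MDiffAt (T% Z) x → (d% (fun y ↦ g.inner y (Y y) (Z y)) x) v
        = g.inner x (cov Y x v) (Z x) + g.inner x (Y x) (cov Z x v)) ↔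
    ∀ v u w, fderiv ℝ (g.coordForm x) (coord x x) v u w
      = g.coordForm x (coord x x) (Γ u v) w + g.coordForm x (coord x x) u (Γ w v) := by
  have key (u w : TangentSpace 𝓘(ℝ, E) x) : g.inner x u w
      = g.coordForm x (coord x x) (toModel x x u) (toModel x x w) := by simp
  constructor
  · intro h0 v u w
    have h1 := h0 (ofModel x x v) _ _ (mdifferentiableAt_constField x u)
      (mdifferentiableAt_constField x w)
    rw [mvfderiv_inner g (mdifferentiableAt_constField x u) (mdifferentiableAt_constField x w),
      key, key, h.toModel_constField, h.toModel_constField,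
      (coordField_constField x u).fderiv_eq, (coordField_constField x w).fderiv_eq] at h1
    simpa [constField] using h1
  · intro h0 v Y Z hY hZ
    rw [mvfderiv_inner g hY hZ, h0, key, key, h Y hY, h Z hZ]
    simp only [map_add, add_apply]
    ring

/-- The derivatives of `Y` cancel, so only the value of `Y` at `x` remains. -/
lemma toModel_derivative_end (h : IsChristoffelAt cov x Γ)
    {A : ∀ y : M, TangentSpace 𝓘(ℝ, E) y →L[ℝ] TangentSpace 𝓘(ℝ, E) y}
    (hA : DifferentiableAt ℝ (coordEnd x A) (coord x x))
    {Y : ∀ y : M, TangentSpace 𝓘(ℝ, E) y} (hY : MDiffAt (T% Y) x) (v : TangentSpace 𝓘(ℝ, E) x) :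
    toModel x x (cov (fun y ↦ A y (Y y)) x v - A x (cov Y x v))
      = fderiv ℝ (coordEnd x A) (coord x x) (toModel x x v) (toModel x x (Y x))
        + Γ (coordEnd x A (coord x x) (toModel x x (Y x))) (toModel x x v)
        - coordEnd x A (coord x x) (Γ (toModel x x (Y x)) (toModel x x v)) := by
  have hY' := (mdifferentiableAt_iff_coordField x Y).1 hY
  have hAY := coordField_apply_coordEnd x A Y
  have h1 : MDiffAt (T% (fun y ↦ A y (Y y))) x := by
    rw [mdifferentiableAt_iff_coordField]
    exact (hA.clm_apply hY').congr_of_eventuallyEq hAY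
  have h2 : toModel x x (A x (cov Y x v)) = coordEnd x A (coord x x) (toModel x x (cov Y x v)) := by
    simp
  rw [map_sub, h2, h _ h1, h Y hY, hAY.fderiv_eq, fderiv_clm_apply hA hY']
  simp
  abel

end IsChristoffelAt

end Charts

/-! ### Maps between manifolds in coordinates. -/

section Charts

open Filter Topology

lemma eventually_map_mem_source {E M F N : Type*} [TopologicalSpace E] [TopologicalSpace M]
    [ChartedSpace E M] [NormedAddCommGroup F] [NormedSpace ℝ F] [TopologicalSpace N]
    [ChartedSpace F N] {φ : N → M} {p : N} (hφ : ContinuousAt φ p) :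
    ∀ᶠ e in 𝓝 (coord (E := F) p p), φ (coordInv p e) ∈ (chartAt E (φ p)).source :=
  (hφ.tendsto.comp (tendsto_coordInv p)).eventually (chart_source_mem_nhds E (φ p))

variable {E : Type*} [NormedAddCommGroup E] [NormedSpace ℝ E]
  {M : Type*} [TopologicalSpace M] [ChartedSpace E M]
  {F : Type*} [NormedAddCommGroup F] [NormedSpace ℝ F]
  {N : Type*} [TopologicalSpace N] [ChartedSpace F N]

/-- The coordinate expression of a map in the preferred charts at `p` and `φ p`. -/
def coordMap (φ : N → M) (p : N) : F → E := coord (φ p) ∘ φ ∘ coordInv p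

@[simp] lemma coordMap_self (φ : N → M) (p : N) :
    coordMap (E := E) (F := F) φ p (coord p p) = coord (φ p) (φ p) := by
  simp [coordMap]

lemma contDiffAt_coordMap {φ : N → M} {p : N} {n : ℕ∞ω}
    (hφ : ContMDiffAt 𝓘(ℝ, F) 𝓘(ℝ, E) n φ p) :
    ContDiffAt ℝ n (coordMap φ p : F → E) (coord p p) := by
  have h := (contMDiffAt_iff.1 hφ).2
  rw [ModelWithCorners.range_eq_univ, contDiffWithinAt_univ] at h
  exact h

variable [IsManifold 𝓘(ℝ, E) ∞ M] [IsManifold 𝓘(ℝ, F) ∞ N]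

/-- The charts stay fixed at `p` and `φ p` while the point moves, since quantities built from this
derivative are differentiated again. -/
lemma eventually_fderiv_coordMap {φ : N → M} (hφ : ContMDiff 𝓘(ℝ, F) 𝓘(ℝ, E) ∞ φ) (p : N) :
    ∀ᶠ e in 𝓝 (coord (E := F) p p), ∀ v : TangentSpace 𝓘(ℝ, F) (coordInv (E := F) p e),
      fderiv ℝ (coordMap φ p : F → E) e (toModel p (coordInv p e) v)
        = toModel (φ p) (φ (coordInv p e)) (mfderiv 𝓘(ℝ, F) 𝓘(ℝ, E) φ (coordInv p e) v) := by
  have hd : ContDiffAt ℝ 1 (coordMap φ p : F → E) (coord p p) :=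
    contDiffAt_coordMap ((hφ p).of_le (by exact_mod_cast le_top))
  filter_upwards [eventually_coordInv_mem_source (E := F) p, eventually_coord_coordInv (E := F) p,
    eventually_map_mem_source (E := E) (F := F) (hφ p).continuousAt,
    hd.eventually (by simp)] with e he he' hφe hde v
  generalize hq : coordInv (E := F) p e = q at *
  have hde : DifferentiableAt ℝ (coordMap φ p : F → E) (coord p q) := by
    rw [he']
    exact hde.differentiableAt one_ne_zero
  have h0 : (coordMap φ p : F → E) ∘ coord p =ᶠ[𝓝 q] coord (φ p) ∘ φ := by
    filter_upwards [(chartAt F p).open_source.mem_nhds he] with y hy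
    simp [coordMap, coordInv_coord hy]
  have h1 := mfderiv_comp (I := 𝓘(ℝ, F)) (I' := 𝓘(ℝ, F)) (I'' := 𝓘(ℝ, E)) q hde.mdifferentiableAt
    (mdifferentiableAt_coord he)
  have h2 := mfderiv_comp (I := 𝓘(ℝ, F)) (I' := 𝓘(ℝ, E)) (I'' := 𝓘(ℝ, E)) q
    (mdifferentiableAt_coord hφe) ((hφ q).mdifferentiableAt (by simp))
  rw [h0.mfderiv_eq, h2, mfderiv_eq_fderiv, he'] at h1
  rw [toModel_eq_mfderiv he, toModel_eq_mfderiv hφe]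
  exact congr($h1 v).symm

lemma SemiRiemannianMetric.coordForm_coord (g : SemiRiemannianMetric E M) {x y : M}
    (hy : y ∈ (chartAt E x).source) (u w : E) :
    g.coordForm x (coord x y) u w = g.inner y (ofModel x y u) (ofModel x y w) := by
  rw [coordForm_apply g (by rwa [coordInv_coord hy])]
  have (z : M) (hz : z = y) : g.inner z (ofModel x z u) (ofModel x z w)
      = g.inner y (ofModel x y u) (ofModel x y w) := by
    subst hz
    rfl
  exact this _ (coordInv_coord hy)

lemma coordEnd_coord {x y : M} (hy : y ∈ (chartAt E x).source)
    (A : ∀ y : M, TangentSpace 𝓘(ℝ, E) y →L[ℝ] TangentSpace 𝓘(ℝ, E) y) (u : E) :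
    coordEnd x A (coord x y) u = toModel x y (A y (ofModel x y u)) := by
  have (z : M) (hz : z = y) : toModel x z (A z (ofModel x z u))
      = toModel x y (A y (ofModel x y u)) := by
    subst hz
    rfl
  exact this _ (coordInv_coord hy)

end Charts

/-! ### Linear algebra of a CR-submersion at one point. -/

section Pointwise

variable {E : Type*} [NormedAddCommGroup E] [NormedSpace ℝ E]
  {M : Type*} [TopologicalSpace M] [ChartedSpace E M] [IsManifold 𝓘(ℝ, E) ∞ M]
  {F : Type*} [NormedAddCommGroup F] [NormedSpace ℝ F]
  {N : Type*} [TopologicalSpace N] [ChartedSpace F N]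
  {E' : Type*} [NormedAddCommGroup E'] [NormedSpace ℝ E']
  {M' : Type*} [TopologicalSpace M'] [ChartedSpace E' M'] [IsManifold 𝓘(ℝ, E') ∞ M']

lemma inducedForm_apply (g : SemiRiemannianMetric E M) (ι : N → M) (p : N)
    (v w : TangentSpace 𝓘(ℝ, F) p) : inducedForm g ι p v w
      = g.inner (ι p) (mfderiv 𝓘(ℝ, F) 𝓘(ℝ, E) ι p v) (mfderiv 𝓘(ℝ, F) 𝓘(ℝ, E) ι p w) := rfl

lemma inducedForm_symm (g : SemiRiemannianMetric E M) (ι : N → M) (p : N)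
    (v w : TangentSpace 𝓘(ℝ, F) p) : inducedForm g ι p v w = inducedForm g ι p w v :=
  g.symm _ _ _

/-- A skew-adjointness property of the members of a canonical local basis. -/
lemma IsCanonicalLocalBasis.inner_apply_left {σ : AlmostParaquaternionicStructure E M}
    {g : SemiRiemannianMetric E M} (hσ : IsAlmostParaquaternionicHermitian σ g) {U : Set M}
    {J : Fin 3 → ∀ x : M, TangentSpace 𝓘(ℝ, E) x →L[ℝ] TangentSpace 𝓘(ℝ, E) x}
    (hJ : IsCanonicalLocalBasis σ.fiber U J) {x : M} (hx : x ∈ U) (α : Fin 3)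
    (v w : TangentSpace 𝓘(ℝ, E) x) :
    g.inner x (J α x v) w = -g.inner x v (J α x w) := by
  -- The hermitian identity for `v` and `J w`, with `J² = -ε` and `ε² = 1`, gives skewness.
  have h1 := hσ U J hJ x hx α v (J α x w)
  have h2 : J α x (J α x w) = (-eps α) • w := congr($(hJ.sq x hx α) w)
  have h3 : eps α * eps α = 1 := by fin_cases α <;> simp [eps]
  rw [h2, map_smul, smul_eq_mul] at h1
  linear_combination (-eps α) * h1 - (g.inner x (J α x v) w + g.inner x v (J α x w)) * h3

variable {σ : AlmostParaquaternionicStructure E M} {g : SemiRiemannianMetric E M} {ι : N → M}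
  {D : ∀ p : N, Submodule ℝ (TangentSpace 𝓘(ℝ, F) p)}
  {σ' : AlmostParaquaternionicStructure E' M'} {g' : SemiRiemannianMetric E' M'} {f : N → M'}

/-- The horizontal lift at a point of a paraquaternionic CR-submersion. -/
lemma IsParaquaternionicCRSubmersion.exists_horizontalLift
    [IsManifold 𝓘(ℝ, F) ∞ N] [FiniteDimensional ℝ F] [FiniteDimensional ℝ E']
    (hN : IsParaquaternionicCRSubmanifold σ g ι D)
    (hf : IsParaquaternionicCRSubmersion σ g ι D σ' g' f) (q : N) :
    ∃ l : TangentSpace 𝓘(ℝ, E') (f q) →L[ℝ] TangentSpace 𝓘(ℝ, F) q,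
      (∀ w, l w ∈ D q) ∧ (∀ w, mfderiv 𝓘(ℝ, F) 𝓘(ℝ, E') f q (l w) = w) ∧
      (∀ v ∈ D q, l (mfderiv 𝓘(ℝ, F) 𝓘(ℝ, E') f q v) = v) ∧
      ∀ w u, inducedForm g ι q (l w) u = g'.inner (f q) w (mfderiv 𝓘(ℝ, F) 𝓘(ℝ, E') f q u) := by
  have : FiniteDimensional ℝ (TangentSpace 𝓘(ℝ, F) q) := inferInstanceAs (FiniteDimensional ℝ F)
  have : FiniteDimensional ℝ (TangentSpace 𝓘(ℝ, E') (f q)) :=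
    inferInstanceAs (FiniteDimensional ℝ E')
  have : T2Space (TangentSpace 𝓘(ℝ, E') (f q)) := inferInstanceAs (T2Space E')
  set B := inducedForm (F := F) g ι q with hB
  have hrefl : B.IsRefl := fun v w h ↦ (inducedForm_symm g ι q w v).trans h
  -- Nondegeneracy on `D q` splits the tangent space into `D q` and its orthogonal complement `ker
  -- f_*`; hence `f_*` is bijective on `D q`, and the lift is its inverse.
  have hcompl : IsCompl (D q) (B.orthogonal (D q)) :=
    LinearMap.BilinForm.isCompl_orthogonal_of_restrict_nondegenerate hrefl
      (hN.nondegenerate_distribution q)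
  let df := mfderiv 𝓘(ℝ, F) 𝓘(ℝ, E') f q
  have hker (v : TangentSpace 𝓘(ℝ, F) q) : v ∈ B.orthogonal (D q) ↔ df v = 0 := by
    rw [← hf.vertical_eq q]
    exact LinearMap.mem_ker
  have hsplit (u : TangentSpace 𝓘(ℝ, F) q) :
      ∃ a ∈ D q, ∃ b ∈ B.orthogonal (D q), a + b = u := by
    have : u ∈ D q ⊔ B.orthogonal (D q) := by
      rw [hcompl.sup_eq_top]
      trivial
    exact Submodule.mem_sup.1 this
  have hbij : Function.Bijective (df.toLinearMap.domRestrict (D q)) := by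
    constructor
    · refine (injective_iff_map_eq_zero _).2 fun v hv ↦ Subtype.ext ?_
      exact (Submodule.disjoint_def.1 hcompl.disjoint) _ v.2 ((hker v).2 hv)
    · intro w
      obtain ⟨u, hu⟩ := hf.submersion.surjective_mfderiv q w
      obtain ⟨a, ha, b, hb, rfl⟩ := hsplit u
      refine ⟨⟨a, ha⟩, ?_⟩
      rw [map_add, (hker b).1 hb, add_zero] at hu
      exact hu
  let e := LinearEquiv.ofBijective _ hbij
  have hdf (w : TangentSpace 𝓘(ℝ, E') (f q)) : df (e.symm w) = w := e.apply_symm_apply w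
  refine ⟨LinearMap.toContinuousLinearMap ((D q).subtype ∘ₗ e.symm.toLinearMap),
    fun w ↦ (e.symm w).2, hdf, fun v hv ↦ ?_, fun w u ↦ ?_⟩
  · exact congrArg Subtype.val (e.symm_apply_apply ⟨v, hv⟩)
  · obtain ⟨a, ha, b, hb, rfl⟩ := hsplit u
    change B (e.symm w : TangentSpace 𝓘(ℝ, F) q) (a + b) = g'.inner (f q) w (df (a + b))
    rw [map_add, map_add, (hker b).1 hb, add_zero, hb _ (e.symm w).2, add_zero,
      ← hf.isometry q _ _ (e.symm w).2 ha]
    exact congr(g'.inner (f q) $(hdf w) (df a))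

/-- At each point, a canonical local basis of `σ'` lifts, on the horizontal space, to a canonical
local basis of `σ`. -/
lemma IsParaquaternionicCRSubmersion.exists_canonicalLocalBasis
    (hf : IsParaquaternionicCRSubmersion σ g ι D σ' g' f) {q : N}
    {l : TangentSpace 𝓘(ℝ, E') (f q) →L[ℝ] TangentSpace 𝓘(ℝ, F) q} (hlD : ∀ w, l w ∈ D q)
    (hfl : ∀ w, mfderiv 𝓘(ℝ, F) 𝓘(ℝ, E') f q (l w) = w)
    (hlf : ∀ v ∈ D q, l (mfderiv 𝓘(ℝ, F) 𝓘(ℝ, E') f q v) = v)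
    {U' : Set M'} {J' : Fin 3 → ∀ x : M', TangentSpace 𝓘(ℝ, E') x →L[ℝ] TangentSpace 𝓘(ℝ, E') x}
    (hJ' : IsCanonicalLocalBasis σ'.fiber U' J') (hq : f q ∈ U') :
    ∃ (U : Set M) (J : Fin 3 → ∀ x : M, TangentSpace 𝓘(ℝ, E) x →L[ℝ] TangentSpace 𝓘(ℝ, E) x),
      IsCanonicalLocalBasis σ.fiber U J ∧ ι q ∈ U ∧
      ∀ α w, mfderiv 𝓘(ℝ, F) 𝓘(ℝ, E) ι q (l (J' α (f q) w))
        = J α (ι q) (mfderiv 𝓘(ℝ, F) 𝓘(ℝ, E) ι q (l w)) := by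
  obtain ⟨U, J, hJ, hU, h⟩ := hf.compatible q U' J' hJ' hq
  refine ⟨U, J, hJ, hU, fun α w ↦ ?_⟩
  obtain ⟨z, hz, h1, h2⟩ := h α (l w) (hlD w)
  rw [hfl] at h2
  rw [← h1, ← h2, hlf z hz]

end Pointwise

/-! ### Passage from coordinates to manifolds, and the theorem. -/

section Main

open Filter Topology

variable {E : Type*} [NormedAddCommGroup E] [NormedSpace ℝ E]
  {M : Type*} [TopologicalSpace M] [ChartedSpace E M] [IsManifold 𝓘(ℝ, E) ∞ M]

/-- A local section of `σ` whose derivative with respect to the Christoffel symbols `Γ` lies in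
`σ`, for all local sections. -/
def IsParallelAt (σ : AlmostParaquaternionicStructure E M) (x : M) (Γ : E →L[ℝ] E →L[ℝ] E) :
    Prop :=
  ∀ (U : Set M) (A : ∀ x : M, TangentSpace 𝓘(ℝ, E) x →L[ℝ] TangentSpace 𝓘(ℝ, E) x),
    IsOpen U → SmoothEndOn A U → (∀ y ∈ U, A y ∈ σ.fiber y) → x ∈ U →
    ∀ v, ∃ B ∈ σ.fiber x, ∀ w, fderiv ℝ (coordEnd x A) (coord x x) v w
      + Γ (coordEnd x A (coord x x) w) v - coordEnd x A (coord x x) (Γ w v)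
        = toModel x x (B (ofModel x x w))

lemma IsParallel.isParallelAt
    {cov : CovariantDerivative 𝓘(ℝ, E) E (TangentSpace 𝓘(ℝ, E) : M → Type _)}
    {σ : AlmostParaquaternionicStructure E M} (h : IsParallel cov σ) {x : M}
    {Γ : E →L[ℝ] E →L[ℝ] E} (hΓ : IsChristoffelAt cov x Γ) : IsParallelAt σ x Γ := by
  intro U A hU hA hAσ hx v
  obtain ⟨B, hB, hBY⟩ := h U A hU hA hAσ x hx (ofModel x x v)
  refine ⟨B, hB, fun w ↦ ?_⟩
  have hw := mdifferentiableAt_constField x w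
  have := hΓ.toModel_derivative_end (differentiableAt_coordEnd hA hU hx) hw (ofModel x x v)
  rw [hBY _ hw] at this
  rw [show constField x w x = ofModel x x w from rfl, toModel_ofModel_self,
    toModel_ofModel_self] at this
  exact this.symm

/-- A family of Christoffel symbols, without any regularity in the base point, suffices for an
almost paraquaternionic hermitian manifold to be paraquaternionic Kähler. -/
lemma isParaquaternionicKahler_of_christoffel [FiniteDimensional ℝ E]
    {σ : AlmostParaquaternionicStructure E M}
    {g : SemiRiemannianMetric E M} (hσ : IsAlmostParaquaternionicHermitian σ g)
    (h : ∀ x : M, ∃ Γ : E →L[ℝ] E →L[ℝ] E, (∀ u v, Γ u v = Γ v u) ∧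
      (∀ v u w, fderiv ℝ (g.coordForm x) (coord x x) v u w
        = g.coordForm x (coord x x) (Γ u v) w + g.coordForm x (coord x x) u (Γ w v)) ∧
      IsParallelAt σ x Γ) :
    IsParaquaternionicKahler σ g := by
  choose Γ hsymm hmetric hpar using h
  have hΓ (x : M) := isChristoffelAt_covOfChristoffel Γ x
  refine ⟨hσ, covOfChristoffel Γ, ⟨?_, fun x v Y Z hY hZ ↦ ?_⟩, fun U A hU hA hAσ x hx v ↦ ?_⟩
  · funext x
    exact (hΓ x).torsion_eq_zero_iff.2 (hsymm x)
  · exact ((hΓ x).compatible_iff g).2 (hmetric x) v Y Z hY hZ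
  · obtain ⟨B, hB, hBw⟩ := hpar x U A hU hA hAσ hx (toModel x x v)
    refine ⟨B, hB, fun Y hY ↦ toModel_injective (mem_chart_source E x) ?_⟩
    rw [(hΓ x).toModel_derivative_end (differentiableAt_coordEnd hA hU hx) hY, hBw,
      ofModel_toModel_self]

variable {F : Type*} [NormedAddCommGroup F] [NormedSpace ℝ F] [FiniteDimensional ℝ F]
  {N : Type*} [TopologicalSpace N] [ChartedSpace F N] [IsManifold 𝓘(ℝ, F) ∞ N]
  {E' : Type*} [NormedAddCommGroup E'] [NormedSpace ℝ E'] [FiniteDimensional ℝ E']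
  {M' : Type*} [TopologicalSpace M'] [ChartedSpace E' M'] [IsManifold 𝓘(ℝ, E') ∞ M']
  {σ : AlmostParaquaternionicStructure E M} {g : SemiRiemannianMetric E M} {ι : N → M}
  {D : ∀ p : N, Submodule ℝ (TangentSpace 𝓘(ℝ, F) p)}
  {σ' : AlmostParaquaternionicStructure E' M'} {g' : SemiRiemannianMetric E' M'} {f : N → M'}

/-- Differentiability of the coordinates of the horizontal lift of a paraquaternionic
CR-submersion. -/
lemma IsParaquaternionicCRSubmersion.exists_differentiableAt_lift
    (hN : IsParaquaternionicCRSubmanifold σ g ι D)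
    (hf : IsParaquaternionicCRSubmersion σ g ι D σ' g' f)
    {hl : ∀ q : N, TangentSpace 𝓘(ℝ, E') (f q) →L[ℝ] TangentSpace 𝓘(ℝ, F) q}
    (hadj : ∀ q w u, inducedForm g ι q (hl q w) u
      = g'.inner (f q) w (mfderiv 𝓘(ℝ, F) 𝓘(ℝ, E') f q u)) (p : N) :
    ∃ l : F → E' →L[ℝ] F, DifferentiableAt ℝ l (coord p p) ∧
      (∀ᶠ e in 𝓝 (coord p p), ∀ w u,
        g.coordForm (ι p) (coordMap ι p e) (fderiv ℝ (coordMap ι p) e (l e w))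
          (fderiv ℝ (coordMap ι p) e u)
        = g'.coordForm (f p) (coordMap f p e) w (fderiv ℝ (coordMap f p) e u)) ∧
      ∀ᶠ e in 𝓝 (coord p p), ∀ w, l e w = toModel p (coordInv p e)
        (hl (coordInv p e) (ofModel (f p) (f (coordInv p e)) w)) := by
  have hι := hN.immersion.contMDiff
  have hfs := hf.submersion.smooth
  have hG : ∀ᶠ e in 𝓝 (coord (E := F) p p), ∀ z u,
      g.coordForm (ι p) (coordMap ι p e) (fderiv ℝ (coordMap ι p) e z)
          (fderiv ℝ (coordMap ι p) e u)
        = inducedForm g ι (coordInv p e) (ofModel p (coordInv p e) z)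
          (ofModel p (coordInv p e) u) := by
    filter_upwards [eventually_coordInv_mem_source (E := F) p,
      eventually_map_mem_source (E := E) (F := F) (hι p).continuousAt,
      eventually_fderiv_coordMap hι p] with e he hιe hde z u
    have h1 := hde (ofModel p (coordInv p e) z)
    have h2 := hde (ofModel p (coordInv p e) u)
    rw [toModel_ofModel he] at h1 h2
    rw [h1, h2, inducedForm_apply]
    refine (g.coordForm_coord hιe _ _).trans ?_
    rw [ofModel_toModel hιe, ofModel_toModel hιe]
  have hG' : ∀ᶠ e in 𝓝 (coord (E := F) p p), ∀ w u,
      g'.coordForm (f p) (coordMap f p e) w (fderiv ℝ (coordMap f p) e u)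
        = inducedForm g ι (coordInv p e)
          (hl (coordInv p e) (ofModel (f p) (f (coordInv p e)) w)) (ofModel p (coordInv p e) u) := by
    filter_upwards [eventually_coordInv_mem_source (E := F) p,
      eventually_map_mem_source (E := E') (F := F) (hfs p).continuousAt,
      eventually_fderiv_coordMap hfs p] with e he hfe hde w u
    have h2 := hde (ofModel p (coordInv p e) u)
    rw [toModel_ofModel he] at h2
    rw [h2, hadj]
    refine (g'.coordForm_coord hfe _ _).trans ?_
    rw [ofModel_toModel hfe]
  have hnd : ∀ᶠ e in 𝓝 (coord (E := F) p p), ∀ z,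
      (∀ u, g.coordForm (ι p) (coordMap ι p e) (fderiv ℝ (coordMap ι p) e z)
          (fderiv ℝ (coordMap ι p) e u) = 0) → z = 0 := by
    filter_upwards [eventually_coordInv_mem_source (E := F) p, hG] with e he hGe z hz
    have h1 : ofModel p (coordInv p e) z = 0 := by
      refine (hN.nondegenerate (coordInv p e)).1 _ fun u ↦ ?_
      have := hz (toModel p (coordInv p e) u)
      rwa [hGe, ofModel_toModel he] at this
    rw [← toModel_ofModel he z, h1, map_zero]
  have htwo : (2 : ℕ∞ω) ≤ ∞ := ENat.LEInfty.out
  obtain ⟨l, hl1, hl2⟩ := exists_differentiableAt_horizontalLift (p := coord p p)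
    (contDiffAt_coordMap ((hι p).of_le htwo)) (contDiffAt_coordMap ((hfs p).of_le htwo))
    (by rw [coordMap_self]; exact g.differentiableAt_coordForm _)
    (by rw [coordMap_self]; exact g'.differentiableAt_coordForm _) hnd.self_of_nhds (by
      filter_upwards [eventually_coordInv_mem_source (E := F) p, hG, hG'] with e he hGe hGe'
      refine ⟨toModel p (coordInv p e) ∘L hl (coordInv p e) ∘L ofModel (f p) (f (coordInv p e)),
        fun w u ↦ ?_⟩
      rw [hGe, hGe']
      simp [ofModel_toModel he])
  refine ⟨l, hl1, hl2, ?_⟩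
  -- The induced form is nondegenerate at all nearby points, so the adjoint equation has one
  -- solution there and `l` must be `hl` in coordinates.
  filter_upwards [eventually_coordInv_mem_source (E := F) p, hG, hG', hl2, hnd]
    with e he hGe hGe' hle hnde w
  rw [← sub_eq_zero]
  refine hnde _ fun u ↦ ?_
  rw [map_sub, map_sub, sub_apply, sub_eq_zero, hle, hGe, hGe', ofModel_toModel he]

/-- The Christoffel symbols of the base of a paraquaternionic CR-submersion at a point of the
image. -/
theorem IsParaquaternionicCRSubmersion.exists_christoffel [FiniteDimensional ℝ E]
    (hM : IsParaquaternionicKahler σ g) (hN : IsParaquaternionicCRSubmanifold σ g ι D)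
    (hM' : IsAlmostParaquaternionicHermitian σ' g')
    (hf : IsParaquaternionicCRSubmersion σ g ι D σ' g' f) (p : N) :
    ∃ Γ' : E' →L[ℝ] E' →L[ℝ] E', (∀ u v, Γ' u v = Γ' v u) ∧
      (∀ v u w, fderiv ℝ (g'.coordForm (f p)) (coord (f p) (f p)) v u w
        = g'.coordForm (f p) (coord (f p) (f p)) (Γ' u v) w
          + g'.coordForm (f p) (coord (f p) (f p)) u (Γ' w v)) ∧
      IsParallelAt σ' (f p) Γ' := by
  have hι := hN.immersion.contMDiff
  have hfs := hf.submersion.smooth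
  obtain ⟨cov, hLC, hpar⟩ := hM.parallel
  obtain ⟨Γ, hΓ⟩ := exists_isChristoffelAt cov (ι p)
  choose hl hlD hfl hlf hadj using fun q : N ↦ hf.exists_horizontalLift hN q
  obtain ⟨l, hl1, hl2, hl3⟩ := hf.exists_differentiableAt_lift hN hadj p
  obtain ⟨U', J', hpU', hJ'⟩ := σ'.exists_basis (f p)
  -- This `J` corresponds to `J'` at `p` only; at other points of `N` the corresponding basis may
  -- differ.
  obtain ⟨U, J, hJ, hpU, hJJ'⟩ := hf.exists_canonicalLocalBasis (hlD p) (hfl p) (hlf p) hJ' hpU'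
  have htwo : (2 : ℕ∞ω) ≤ ∞ := ENat.LEInfty.out
  have hloc : LocalSubmersion (coordMap ι p) (coordMap f p) l (g.coordForm (ι p))
      (g'.coordForm (f p)) Γ (coord p p) :=
    { contDiff_i := contDiffAt_coordMap ((hι p).of_le htwo)
      contDiff_f := contDiffAt_coordMap ((hfs p).of_le htwo)
      diff_l := hl1
      diff_G := by rw [coordMap_self]; exact g.differentiableAt_coordForm _
      diff_G' := by rw [coordMap_self]; exact g'.differentiableAt_coordForm _
      symm := fun u w ↦ by simp [g.symm (ι p) (ofModel (ι p) (ι p) u)]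
      symm' := fun u w ↦ by simp [g'.symm (f p) (ofModel (f p) (f p) u)]
      nondeg' := fun u hu ↦ by
        have h1 : ofModel (f p) (f p) u = 0 := g'.nondegenerate (f p) _ fun w ↦ by
          simpa using hu (toModel (f p) (f p) w)
        rw [← toModel_ofModel_self (f p) u, h1, map_zero]
      adjoint := hl2
      section_l := by
        filter_upwards [hl3, eventually_fderiv_coordMap hfs p,
          eventually_map_mem_source (E := E') (F := F) (hfs p).continuousAt] with e h1 h2 hfe w
        rw [h1, h2, hfl, toModel_ofModel hfe]
      torsionFree := hΓ.torsion_eq_zero_iff.1 (congrFun hLC.torsion_eq_zero (ι p))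
      metric := by
        rw [coordMap_self]
        exact (hΓ.compatible_iff g).1 (hLC.compatible (ι p)) }
  have hL : ∀ᶠ e in 𝓝 (coord (E := F) p p), ∀ w, ambientLift (coordMap ι p) l e w
      = toModel (ι p) (ι (coordInv p e)) (mfderiv 𝓘(ℝ, F) 𝓘(ℝ, E) ι (coordInv p e)
        (hl (coordInv p e) (ofModel (f p) (f (coordInv p e)) w))) := by
    filter_upwards [hl3, eventually_fderiv_coordMap hι p] with e h1 h2 w
    rw [← h2, ← h1]
    rfl
  have hLp (w : E') : ambientLift (coordMap ι p) l (coord p p) w = toModel (ι p) (ι p)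
      (mfderiv 𝓘(ℝ, F) 𝓘(ℝ, E) ι p (hl p (ofModel (f p) (f p) w))) := by
    have (q : N) (hq : q = p) : toModel (ι p) (ι q) (mfderiv 𝓘(ℝ, F) 𝓘(ℝ, E) ι q
        (hl q (ofModel (f p) (f q) w))) = toModel (ι p) (ι p)
      (mfderiv 𝓘(ℝ, F) 𝓘(ℝ, E) ι p (hl p (ofModel (f p) (f p) w))) := by
      subst hq
      rfl
    rw [hL.self_of_nhds w]
    exact this _ (coordInv_coord_self p)
  have hJd (β : Fin 3) := differentiableAt_coordEnd (hJ.smooth β) hJ.isOpen hpU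
  obtain ⟨Γ', h1, h2, h3⟩ := hloc.exists_christoffel (fun β ↦ coordEnd (ι p) (J β))
    (fun β ↦ coordEnd (f p) (J' β) (coord (f p) (f p)))
    (fun β ↦ by rw [coordMap_self]; exact hJd β)
    (fun β v ↦ by
      obtain ⟨B, hB, hBw⟩ := hpar.isParallelAt hΓ U (J β) hJ.isOpen (hJ.smooth β)
        (fun y hy ↦ by rw [← hJ.span_eq y hy]; exact Submodule.subset_span ⟨β, rfl⟩) hpU v
      rw [← hJ.span_eq _ hpU, Submodule.mem_span_range_iff_exists_fun] at hB
      obtain ⟨c, rfl⟩ := hB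
      refine ⟨c, fun u ↦ ?_⟩
      rw [coordMap_self, hBw]
      simp [sum_apply])
    (fun β u w ↦ by simp [hJ.inner_apply_left hM.hermitian hpU])
    (fun β u w ↦ by simp [hJ'.inner_apply_left hM' hpU'])
    (fun β w ↦ by
      rw [hLp, hLp, coordMap_self]
      simp [hJJ'])
    (by
      rw [Fintype.linearIndependent_iff]
      intro c hc
      refine Fintype.linearIndependent_iff.1 (hJ'.linearIndependent (f p) hpU') c ?_
      ext w
      refine toModel_injective (mem_chart_source E' (f p)) ?_
      have := congr($hc (toModel (f p) (f p) w))
      simpa [sum_apply] using this)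
  rw [coordMap_self] at h2 h3
  refine ⟨Γ', h1, h2, fun V A hV hA hAσ hpV v ↦ ?_⟩
  obtain ⟨c, hc⟩ := h3 (coordEnd (f p) A) (differentiableAt_coordEnd hA hV hpV) (by
    have hq := tendsto_coordInv (E := F) p
    filter_upwards [hL, eventually_map_mem_source (E := E) (F := F) (hι p).continuousAt,
      eventually_map_mem_source (E := E') (F := F) (hfs p).continuousAt,
      ((hfs p).continuousAt.tendsto.comp hq).eventually (hV.mem_nhds hpV),
      ((hfs p).continuousAt.tendsto.comp hq).eventually (hJ'.isOpen.mem_nhds hpU'),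
      ((hι p).continuousAt.tendsto.comp hq).eventually (hJ.isOpen.mem_nhds hpU)]
      with e hLe hιe hfe hVe hU'e hUe
    replace hVe : f (coordInv p e) ∈ V := hVe
    replace hU'e : f (coordInv p e) ∈ U' := hU'e
    replace hUe : ι (coordInv p e) ∈ U := hUe
    -- At the nearby point, `A` lifts to a combination of a basis `Jq` adapted to that point. Since
    -- the combination lies in `σ`, it can be expanded again in the fixed basis `J`.
    obtain ⟨Uq, Jq, hJq, hqU, hJJq⟩ := hf.exists_canonicalLocalBasis (hlD (coordInv p e))
      (hfl (coordInv p e)) (hlf (coordInv p e)) hJ' hU'e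
    have hAe := hAσ _ hVe
    rw [← hJ'.span_eq _ hU'e, Submodule.mem_span_range_iff_exists_fun] at hAe
    obtain ⟨a, ha⟩ := hAe
    have hBe : ∑ β, a β • Jq β (ι (coordInv p e)) ∈ σ.fiber (ι (coordInv p e)) := by
      rw [← hJq.span_eq _ hqU, Submodule.mem_span_range_iff_exists_fun]
      exact ⟨a, rfl⟩
    rw [← hJ.span_eq _ hUe, Submodule.mem_span_range_iff_exists_fun] at hBe
    obtain ⟨c, hc⟩ := hBe
    refine ⟨c, fun w ↦ ?_⟩
    have hAw : coordEnd (f p) A (coordMap f p e) w = toModel (f p) (f (coordInv p e))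
        (A _ (ofModel (f p) (f (coordInv p e)) w)) := coordEnd_coord hfe A w
    have hJw (β : Fin 3) (u : E) : coordEnd (ι p) (J β) (coordMap ι p e) u
        = toModel (ι p) (ι (coordInv p e)) (J β _ (ofModel (ι p) (ι (coordInv p e)) u)) :=
      coordEnd_coord hιe (J β) u
    have hcw := congr(toModel (ι p) (ι (coordInv p e)) ($hc (mfderiv 𝓘(ℝ, F) 𝓘(ℝ, E) ι
      (coordInv p e) (hl (coordInv p e) (ofModel (f p) (f (coordInv p e)) w)))))
    simp only [sum_apply, smul_apply, map_sum, map_smul] at hcw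
    rw [hLe, hLe, hAw, ofModel_toModel hfe]
    simp only [hJw, ofModel_toModel hιe, ← ha, sum_apply, smul_apply, map_sum, map_smul, hJJq, hcw])
    v
  refine ⟨∑ β, c β • J' β (f p), ?_, fun w ↦ ?_⟩
  · rw [← hJ'.span_eq _ hpU', Submodule.mem_span_range_iff_exists_fun]
    exact ⟨c, rfl⟩
  · rw [hc]
    simp [sum_apply]

end Main

end ParaquaternionicCR

end

theorem mainTheorem8
    {E : Type*} [NormedAddCommGroup E] [NormedSpace ℝ E] [FiniteDimensional ℝ E]
    {M : Type*} [TopologicalSpace M] [T2Space M] [SecondCountableTopology M]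
    [ChartedSpace E M] [IsManifold 𝓘(ℝ, E) ∞ M]
    {F : Type*} [NormedAddCommGroup F] [NormedSpace ℝ F] [FiniteDimensional ℝ F]
    {N : Type*} [TopologicalSpace N] [T2Space N] [SecondCountableTopology N]
    [ChartedSpace F N] [IsManifold 𝓘(ℝ, F) ∞ N]
    {E' : Type*} [NormedAddCommGroup E'] [NormedSpace ℝ E'] [FiniteDimensional ℝ E']
    {M' : Type*} [TopologicalSpace M'] [T2Space M'] [SecondCountableTopology M']
    [ChartedSpace E' M'] [IsManifold 𝓘(ℝ, E') ∞ M']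
    (σ : ParaquaternionicCR.AlmostParaquaternionicStructure E M)
    (g : ParaquaternionicCR.SemiRiemannianMetric E M)
    (hM : ParaquaternionicCR.IsParaquaternionicKahler σ g)
    (ι : N → M) (D : ∀ p : N, Submodule ℝ (TangentSpace 𝓘(ℝ, F) p))
    (hN : ParaquaternionicCR.IsParaquaternionicCRSubmanifold σ g ι D)
    (σ' : ParaquaternionicCR.AlmostParaquaternionicStructure E' M')
    (g' : ParaquaternionicCR.SemiRiemannianMetric E' M')
    (hM' : ParaquaternionicCR.IsAlmostParaquaternionicHermitian σ' g')
    (f : N → M')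
    (hf : ParaquaternionicCR.IsParaquaternionicCRSubmersion σ g ι D σ' g' f) :
    ParaquaternionicCR.IsParaquaternionicKahler σ' g' := by
  refine ParaquaternionicCR.isParaquaternionicKahler_of_christoffel hM' fun x ↦ ?_
  -- Any point of the fibre over `x` serves, because the choices at different `x` need not be
  -- related.
  obtain ⟨p, rfl⟩ := hf.submersion.surjective x
  exact hf.exists_christoffel hM hN hM' p
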